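/- Let $A=\{0,\dots,m-1\}$ with $m\ge 2$, let $D\ge 0$ and $\beta\in(0,1)$. Let $\mathcal T(D)$ be the set of proper $m$-ary trees of depth at most $D$ (every internal node has all $m$ children), each tree $T$ being identified with the set of its leaves; nodes are viewed as contexts, i.e. words over $A$ of length at most $D$, the children of $s$ being obtained by prolonging $s$ one symbol further into the past. Let $|T|$ be the number of leaves of $T$ and $L_D(T)$ the number of its leaves at depth $D$. A variable-memory chain with model $T\in\mathcal T(D)$ and parameters $\theta=\{\theta_s;s\in T\}$ (probability vectors on $A$) is an $A$-valued process $(X_n)_{n\ge -D+1}$, with arbitrary initial context $X_{-D+1}^0$, such that for $n\ge1$ the conditional probability of $X_n=j$ given $X_{-D+1}^{n-1}$ is $\theta_s(j)$, where $s$ is the unique leaf of $T$ that is a suffix of $X_{n-D}^{n-1}$. It is ergodic if the first-order Markov chain $Z_n=X_{n-D+1}^n$ is irreducible and aperiodic on $A^D$. The model $T$ is minimal with respect to $\theta$ if $T$ consists of the root only, or if any $m$ sibling leaves $s0,\dots,s(m-1)$ of $T$ include two with $\theta_{sj}\neq\theta_{sj'}$. Put on $\mathcal T(D)$ the prior $\pi_D(T)=\alpha^{|T|-1}\beta^{|T|-L_D(T)}$,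 $\alpha=(1-\beta)^{1/(m-1)}$, and, given $T$, let the $\theta_s$, $s\in T$, be independent with the $\mathrm{Dirichlet}(1/2,\dots,1/2)$ distribution. For a string $x=x_{-D+1}^n$ let $P(x|T)=\int\prod_{s\in T}\prod_{j\in A}\theta_s(j)^{a_s(j)}\,\pi(d\theta|T)$ be the marginal likelihood of $x_1^n$ given the initial context $x_{-D+1}^0$, where $a_s(j)$ is the number of times that $j$ follows the context $s$ in $x_1^n$, and let $$\pi(T|x)=\frac{\pi_D(T)P(x|T)}{\sum_{T'\in\mathcal T(D)}\pi_D(T')P(x|T')}$$ be the posterior probability of $T$. Theorem. Let $(X_n)$ be an ergodic variable-memory chain with model $T^*\in\mathcal T(D)$ that is minimal with respect to its parameters $\theta^*$. Then, for any $\beta\in(0,1)$, $$\pi(T^*|X_{-D+1}^n)\to 1\qquad\text{almost surely as }n\to\infty .$$ -/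

import Mathlib

open Filter Topology MeasureTheory

/-! Bayesian context trees over the alphabet `Fin m`.

A context is a word `s : List (Fin m)`, written with the most recent symbol first; the children of
`s` in the `m`-ary tree are the words `s ++ [j]`. A tree is represented by the set of its leaves. -/

namespace BCT

/-- `T` is the set of leaves of a finite proper `m`-ary tree: it is nonempty, no leaf is an ancestor
of another leaf, and every child of an internal node (a strict ancestor of a leaf) is a node. -/
structure IsProperTree {m : ℕ} (T : Finset (List (Fin m))) : Prop where
  nonempty : T.Nonempty
  prefix_free : ∀ s ∈ T, ∀ t ∈ T, s <+: t → s = t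
  proper : ∀ u : List (Fin m), (∃ s ∈ T, u <+: s ∧ u ≠ s) → ∀ j, ∃ s ∈ T, u ++ [j] <+: s

/-- All words of length at most `D`. -/
def wordsUpTo (m D : ℕ) : Finset (List (Fin m)) :=
  (Finset.range (D + 1)).biUnion fun k =>
    Finset.univ.image fun v : Fin k → Fin m => List.ofFn v

open Classical in
/-- The collection of all proper `m`-ary trees of depth at most `D`. -/
noncomputable def models (m D : ℕ) : Finset (Finset (List (Fin m))) :=
  (wordsUpTo m D).powerset.filter IsProperTree

theorem mem_wordsUpTo {m D : ℕ} {s : List (Fin m)} : s ∈ wordsUpTo m D ↔ s.length ≤ D := by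
  simp only [wordsUpTo, Finset.mem_biUnion, Finset.mem_range, Finset.mem_image, Finset.mem_univ,
    true_and]
  constructor
  · rintro ⟨k, hk, v, rfl⟩
    simp only [List.length_ofFn]
    omega
  · intro h
    exact ⟨s.length, by omega, s.get, List.ofFn_get s⟩

theorem mem_models {m D : ℕ} {T : Finset (List (Fin m))} :
    T ∈ models m D ↔ IsProperTree T ∧ ∀ s ∈ T, s.length ≤ D := by
  simp only [models, Finset.mem_filter, Finset.mem_powerset, Finset.subset_iff, mem_wordsUpTo]
  exact and_comm

/-! ### The prior and the posterior

A sequence of symbols is `x : ℕ → Fin m`. The first `D` symbols `x 0, …, x (D - 1)` are the initial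
context, and `x D, x (D + 1), …` are the successive observations (so `x k` is the symbol that is
customarily written `x_{k - D + 1}`). -/

/-- The window of length `D` starting at position `i`, in chronological order; these are the `D`
symbols immediately before `x (D + i)`. -/
def window {m : ℕ} (D : ℕ) (x : ℕ → Fin m) (i : ℕ) : Fin D → Fin m := fun k => x (i + k)

/-- The context `s` (most recent symbol first) is a suffix of the string `z`. -/
abbrev Matches {m D : ℕ} (s : List (Fin m)) (z : Fin D → Fin m) : Prop :=
  s <+: (List.ofFn z).reverse

/-- `a_s(j)`: the number of times that symbol `j` follows the context `s` among the first `n`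
observations. -/
def count {m : ℕ} (D : ℕ) (x : ℕ → Fin m) (n : ℕ) (s : List (Fin m)) (j : Fin m) : ℕ :=
  ((Finset.range n).filter fun i => Matches s (window D x i) ∧ x (D + i) = j).card

/-- The likelihood of the first `n` observations given the initial context, the model `T` and its
parameters `θ`. -/
def likelihood {m : ℕ} (D : ℕ) (T : Finset (List (Fin m))) (x : ℕ → Fin m) (n : ℕ)
    (θ : T → Fin m → ℝ) : ℝ :=
  ∏ s : T, ∏ j : Fin m, θ s j ^ count D x n s j

/-- The solid simplex that parametrizes the probability vectors on `Fin m` by their first `m - 1`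
coordinates. -/
def solidSimplex (m : ℕ) : Set (Fin (m - 1) → ℝ) :=
  {φ | (∀ i, 0 ≤ φ i) ∧ ∑ i, φ i ≤ 1}

/-- The vector whose first `m - 1` coordinates are `φ` and whose coordinates sum to one. -/
def paramMap (m : ℕ) (φ : Fin (m - 1) → ℝ) : Fin m → ℝ :=
  fun j => if h : (j : ℕ) < m - 1 then φ ⟨j, h⟩ else 1 - ∑ i, φ i

/-- The Dirichlet distribution with parameters `(1/2, …, 1/2)`, as a measure on vectors indexed by
`Fin m`. -/
noncomputable def dirichletHalf (m : ℕ) : Measure (Fin m → ℝ) :=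
  ((volume.restrict (solidSimplex m)).withDensity fun φ =>
    ENNReal.ofReal (Real.Gamma ((m : ℝ) / 2) / Real.pi ^ ((m : ℝ) / 2) *
      ∏ j : Fin m, paramMap m φ j ^ (-(1 / 2 : ℝ)))).map (paramMap m)

/-- The prior on the parameters given the model `T`: independent Dirichlet vectors at the leaves. -/
noncomputable def paramPrior {m : ℕ} (T : Finset (List (Fin m))) : Measure (T → Fin m → ℝ) :=
  Measure.pi fun _ => dirichletHalf m

/-- The marginal likelihood of the first `n` observations given the model `T`. -/
noncomputable def marginalLikelihood {m : ℕ} (D : ℕ) (T : Finset (List (Fin m))) (x : ℕ → Fin m)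
    (n : ℕ) : ℝ :=
  ∫ θ, likelihood D T x n θ ∂(paramPrior T)

/-- The prior on models, `α ^ (|T| - 1) * β ^ (|T| - L_D(T))` with `α = (1 - β) ^ (1 / (m - 1))`,
where `L_D(T)` is the number of leaves of `T` at depth `D`. -/
noncomputable def modelPrior {m : ℕ} (D : ℕ) (β : ℝ) (T : Finset (List (Fin m))) : ℝ :=
  ((1 - β) ^ (1 / ((m : ℝ) - 1))) ^ (T.card - 1) *
    β ^ (T.card - (T.filter fun s => s.length = D).card)

/-- The prior predictive likelihood of the first `n` observations. -/
noncomputable def priorPredictive {m : ℕ} (D : ℕ) (β : ℝ) (x : ℕ → Fin m) (n : ℕ) : ℝ :=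
  ∑ T ∈ models m D, modelPrior D β T * marginalLikelihood D T x n

/-- The posterior probability of the model `T` given the initial context and the first `n`
observations. -/
noncomputable def posterior {m : ℕ} (D : ℕ) (β : ℝ) (T : Finset (List (Fin m))) (x : ℕ → Fin m)
    (n : ℕ) : ℝ :=
  modelPrior D β T * marginalLikelihood D T x n / priorPredictive D β x n

/-! ### Variable-memory Markov chains -/

/-- `θ` assigns a probability vector to every leaf of `T`. -/
def IsParam {m : ℕ} (T : Finset (List (Fin m))) (θ : T → Fin m → ℝ) : Prop :=
  ∀ s, (∀ j, 0 ≤ θ s j) ∧ ∑ j, θ s j = 1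

/-- The conditional probability `θ_s(j)` of the symbol `j` given that the last `D` symbols are `z`,
where `s` is the leaf of `T` that is a suffix of `z` (for a proper tree of depth at most `D` there
is exactly one such leaf, hence the sum has only one term). -/
def condProb {m D : ℕ} (T : Finset (List (Fin m))) (θ : T → Fin m → ℝ) (z : Fin D → Fin m)
    (j : Fin m) : ℝ :=
  ∑ s : T, if Matches (s : List (Fin m)) z then θ s j else 0

/-- The string obtained from `z` by appending `j` and dropping the oldest symbol. -/
def shift {m D : ℕ} (z : Fin D → Fin m) (j : Fin m) : Fin D → Fin m :=
  Fin.tail (Fin.snoc (α := fun _ => Fin m) z j)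

/-- The transition matrix of the first order chain of the last `D` symbols. -/
def transition {m : ℕ} (D : ℕ) (T : Finset (List (Fin m))) (θ : T → Fin m → ℝ) :
    Matrix (Fin D → Fin m) (Fin D → Fin m) ℝ :=
  fun z w => ∑ j, if shift z j = w then condProb T θ z j else 0

/-- Aperiodicity: for every state `i`, the greatest common divisor of the possible return times is
one. -/
def IsAperiodic {ι : Type*} [Fintype ι] [DecidableEq ι] (P : Matrix ι ι ℝ) : Prop :=
  ∀ i, ∀ d : ℕ, (∀ k > 0, 0 < (P ^ k) i i → d ∣ k) → d = 1

/-- The variable-memory chain with model `T` and parameters `θ` is ergodic: the first order chain of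
the last `D` symbols is irreducible and aperiodic on the set of all strings of length `D`. -/
def IsErgodic {m : ℕ} (D : ℕ) (T : Finset (List (Fin m))) (θ : T → Fin m → ℝ) : Prop :=
  (transition D T θ).IsIrreducible ∧ IsAperiodic (transition D T θ)

/-- `T` is minimal with respect to `θ`: it consists of the root only, or among any `m` sibling
leaves there are two with different parameters. -/
def IsMinimal {m : ℕ} (T : Finset (List (Fin m))) (θ : T → Fin m → ℝ) : Prop :=
  T = {[]} ∨ ∀ (s : List (Fin m)) (h : ∀ j, s ++ [j] ∈ T),
    ∃ j j', θ ⟨s ++ [j], h j⟩ ≠ θ ⟨s ++ [j'], h j'⟩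

/-- `X` is a variable-memory chain with model `T` and parameters `θ` under `μ`, with an arbitrary
(possibly random) initial context `X 0, …, X (D - 1)`: given all the earlier symbols, the symbol
`X (D + n)` has the distribution prescribed by the last `D` of them. -/
structure IsVariableMemoryChain {Ω : Type*} [MeasurableSpace Ω] (μ : Measure Ω) {m : ℕ} (D : ℕ)
    (T : Finset (List (Fin m))) (θ : T → Fin m → ℝ) (X : ℕ → Ω → Fin m) : Prop where
  measurable : ∀ k, Measurable (X k)
  step : ∀ (n : ℕ) (w : ℕ → Fin m),
    μ {ω | ∀ k < D + n + 1, X k ω = w k} =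
      μ {ω | ∀ k < D + n, X k ω = w k} *
        ENNReal.ofReal (condProb T θ (window D w n) (w (D + n)))

end BCT

/-! The posterior odds of a tree `T'` against the true tree `T` are a ratio of marginal likelihoods,
and the marginal likelihood of a tree is the product over its leaves `s` of the
Krichevsky–Trofimov probabilities of the counts at `s`. These are explicit ratios of Gamma functions
(`lintegral_dirichlet`, `marginalLikelihood_eq`), and Stirling's formula gives
`log = maximal log-likelihood - (m - 1) / 2 * log (visits to s) + O(1)`, uniformly in the counts
(`exists_log_ktProb_bound`). What remains is to compare maximal log-likelihoods, and for this every
tree is compared with the finest one, whose contexts are the strings `z` of length `D`.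

* The finest tree, hence every tree, gains over the true parameters at most the `χ²` statistic of
  the transition counts (`sum_maxLogLik_le_logLik_add`). This is `o(log n)`: the exponential
  supermartingales `exp (λ S - λ² V)` of a centred count `S` with `V` visits, mixed over `λ = 2⁻ⁱ`
  with weights `(i + 1)⁻²`, stay bounded, so that `S² / n` is at most of order `(log log n)²`
  (`ae_centredCount_sq_le`), while `V` grows linearly.
* A leaf of `T'` matched by two strings with different conditional distributions loses a linear
  amount of log-likelihood (`IsTypical.mergingLoss_linear`).
* If no leaf of `T'` does this, then minimality of `T` makes `T'` a strict refinement of `T`, with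
  more leaves (`exists_merged_or_card_lt`), so that it pays at least one more term
  `(m - 1) / 2 * log n`.

Linear growth of the number of visits to each string comes from irreducibility through an
exponential Lyapunov function (`ae_visits_linear`). Both this bound and the fluctuation bound rest
on the almost sure boundedness of nonnegative supermartingales that are functionals of the path
(`ae_bounded_of_superharmonic`). -/

namespace BCT

/-! ### The Dirichlet integral -/

theorem lintegral_beta_scaled {a b t : ℝ} (ha : 0 < a) (hb : 0 < b) (ht : 0 < t) :
    ∫⁻ y in Set.Ioo 0 t, ENNReal.ofReal (y ^ (a - 1) * (t - y) ^ (b - 1)) =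
      ENNReal.ofReal (t ^ (a + b - 1) * ProbabilityTheory.beta a b) := by
  have hB := ProbabilityTheory.beta_pos ha hb
  have h1 : ∫⁻ x in Set.Ioo (0 : ℝ) 1, ENNReal.ofReal (x ^ (a - 1) * (1 - x) ^ (b - 1)) =
      ENNReal.ofReal (ProbabilityTheory.beta a b) := by
    have h := ProbabilityTheory.lintegral_betaPDF_eq_one ha hb
    rw [ProbabilityTheory.lintegral_betaPDF] at h
    calc _ = ∫⁻ x in Set.Ioo (0 : ℝ) 1, ENNReal.ofReal (ProbabilityTheory.beta a b) *
          ENNReal.ofReal (1 / ProbabilityTheory.beta a b * x ^ (a - 1) * (1 - x) ^ (b - 1)) := by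
          refine lintegral_congr fun x => ?_
          rw [← ENNReal.ofReal_mul hB.le]
          congr 1
          field_simp
      _ = _ := by
          rw [lintegral_const_mul _ (by fun_prop), h, mul_one]
  rw [← lintegral_indicator measurableSet_Ioo,
    ← Real.smul_map_volume_mul_left ht.ne', lintegral_smul_measure,
    lintegral_map ((by fun_prop : Measurable fun y : ℝ =>
      ENNReal.ofReal (y ^ (a - 1) * (t - y) ^ (b - 1))).indicator measurableSet_Ioo)
      (by fun_prop), abs_of_pos ht]
  have h2 : ∀ x : ℝ, (Set.Ioo 0 t).indicator
      (fun y => ENNReal.ofReal (y ^ (a - 1) * (t - y) ^ (b - 1))) (t * x) =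
      ENNReal.ofReal (t ^ (a + b - 2)) * (Set.Ioo 0 1).indicator
      (fun x => ENNReal.ofReal (x ^ (a - 1) * (1 - x) ^ (b - 1))) x := by
    intro x
    by_cases hx : x ∈ Set.Ioo (0 : ℝ) 1
    · have hx' : t * x ∈ Set.Ioo 0 t := ⟨mul_pos ht hx.1, by nlinarith [hx.2]⟩
      rw [Set.indicator_of_mem hx, Set.indicator_of_mem hx', ← ENNReal.ofReal_mul (by positivity)]
      have h3 : t - t * x = t * (1 - x) := by ring
      rw [h3, Real.mul_rpow ht.le hx.1.le, Real.mul_rpow ht.le (by linarith [hx.2]),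
        show a + b - 2 = (a - 1) + (b - 1) by ring, Real.rpow_add ht]
      congr 1
      ring
    · have hx' : t * x ∉ Set.Ioo 0 t := fun h =>
        hx ⟨pos_of_mul_pos_right h.1 ht.le, by nlinarith [h.2]⟩
      rw [Set.indicator_of_notMem hx, Set.indicator_of_notMem hx', mul_zero]
  simp_rw [h2]
  rw [lintegral_const_mul _ ((by fun_prop : Measurable fun x : ℝ =>
      ENNReal.ofReal (x ^ (a - 1) * (1 - x) ^ (b - 1))).indicator measurableSet_Ioo),
    lintegral_indicator measurableSet_Ioo, h1, smul_eq_mul, ← mul_assoc,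
    ← ENNReal.ofReal_mul ht.le, ← ENNReal.ofReal_mul (by positivity)]
  congr 2
  rw [show a + b - 1 = 1 + (a + b - 2) by ring, Real.rpow_add ht, Real.rpow_one]

/-- The solid simplex of size `t` in dimension `k`. -/
def scaledSimplex (k : ℕ) (t : ℝ) : Set (Fin k → ℝ) :=
  {φ | (∀ i, 0 ≤ φ i) ∧ ∑ i, φ i ≤ t}

theorem measurableSet_scaledSimplex (k : ℕ) (t : ℝ) : MeasurableSet (scaledSimplex k t) := by
  refine MeasurableSet.inter (s₁ := {φ : Fin k → ℝ | ∀ i, 0 ≤ φ i})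
    (s₂ := {φ : Fin k → ℝ | ∑ i, φ i ≤ t}) ?_ ?_
  · rw [Set.ofPred_forall]
    exact MeasurableSet.iInter fun i => measurableSet_le (by fun_prop) (by fun_prop)
  · exact measurableSet_le (by fun_prop) (by fun_prop)

/-- The Dirichlet integral over the solid simplex; integrating out the first coordinate leaves the
same integral in one dimension less, over the simplex of size `t - y`, and a Beta integral. -/
theorem lintegral_dirichlet (k : ℕ) (b : Fin k → ℝ) (hb : ∀ i, 0 < b i) {c t : ℝ} (hc : 0 < c)
    (ht : 0 < t) :
    ∫⁻ φ in scaledSimplex k t,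
        ENNReal.ofReal ((∏ i, φ i ^ (b i - 1)) * (t - ∑ i, φ i) ^ (c - 1)) =
      ENNReal.ofReal (t ^ (∑ i, b i + c - 1) *
        ((∏ i, Real.Gamma (b i)) * Real.Gamma c / Real.Gamma (∑ i, b i + c))) := by
  induction k generalizing t with
  | zero =>
    have : scaledSimplex 0 t = Set.univ := by
      ext φ
      simp [scaledSimplex, ht.le]
    rw [this, Measure.restrict_univ, volume_pi, Measure.pi_of_empty _ (fun i => i.elim0),
      lintegral_dirac]
    simp [(Real.Gamma_pos_of_pos hc).ne']
  | succ k ih =>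
    have hbs : 0 ≤ ∑ i : Fin k, b i.succ := Finset.sum_nonneg fun i _ => (hb _).le
    have hΓ : 0 < Real.Gamma (∑ i : Fin k, b i.succ + c) := Real.Gamma_pos_of_pos (by linarith)
    set K : ℝ := (∏ i : Fin k, Real.Gamma (b i.succ)) * Real.Gamma c /
      Real.Gamma (∑ i : Fin k, b i.succ + c) with hK
    have hK0 : 0 ≤ K := div_nonneg (mul_nonneg (Finset.prod_nonneg fun i _ =>
      (Real.Gamma_pos_of_pos (hb _)).le) (Real.Gamma_pos_of_pos hc).le) hΓ.le
    rw [← lintegral_indicator (measurableSet_scaledSimplex _ _)]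
    set G : (Fin (k + 1) → ℝ) → ENNReal := (scaledSimplex (k + 1) t).indicator fun φ =>
      ENNReal.ofReal ((∏ i, φ i ^ (b i - 1)) * (t - ∑ i, φ i) ^ (c - 1)) with hG
    have hGm : Measurable G :=
      (by fun_prop : Measurable fun φ : Fin (k + 1) → ℝ => ENNReal.ofReal
        ((∏ i, φ i ^ (b i - 1)) * (t - ∑ i, φ i) ^ (c - 1))).indicator
        (measurableSet_scaledSimplex _ _)
    have hmp := (volume_preserving_piFinSuccAbove (fun _ : Fin (k + 1) => ℝ) 0).symm
    rw [← hmp.lintegral_comp hGm, Measure.volume_eq_prod,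
      lintegral_prod (fun a => G ((MeasurableEquiv.piFinSuccAbove _ 0).symm a))
        (hGm.comp hmp.measurable).aemeasurable]
    have key : ∀ᵐ y : ℝ, (∫⁻ φ : Fin k → ℝ,
        G ((MeasurableEquiv.piFinSuccAbove (fun _ : Fin (k + 1) => ℝ) 0).symm (y, φ))) =
        (Set.Ioo 0 t).indicator (fun y => ENNReal.ofReal K *
          ENNReal.ofReal (y ^ (b 0 - 1) * (t - y) ^ (∑ i : Fin k, b i.succ + c - 1))) y := by
      -- At `y = t` the remaining simplex is degenerate; the end points form a null set.
      have h0 : ∀ᵐ y : ℝ, y ≠ 0 := by simp [ae_iff]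
      have h1 : ∀ᵐ y : ℝ, y ≠ t := by simp [ae_iff]
      filter_upwards [h0, h1] with y hy0 hyt
      have hcons : ∀ φ : Fin k → ℝ,
          (MeasurableEquiv.piFinSuccAbove (fun _ : Fin (k + 1) => ℝ) 0).symm (y, φ) =
            Fin.cons y φ := fun φ => by
        simp [MeasurableEquiv.piFinSuccAbove_symm_apply, Fin.insertNthEquiv]
      simp_rw [hcons]
      have hmem : ∀ φ : Fin k → ℝ, (Fin.cons y φ : Fin (k + 1) → ℝ) ∈ scaledSimplex (k + 1) t ↔
          0 ≤ y ∧ φ ∈ scaledSimplex k (t - y) := fun φ => by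
        simp only [scaledSimplex, Set.mem_ofPred_eq, Fin.forall_fin_succ, Fin.cons_zero,
          Fin.cons_succ, Fin.sum_univ_succ, and_assoc, le_sub_iff_add_le, add_comm y]
      by_cases hy : y ∈ Set.Ioo 0 t
      · rw [Set.indicator_of_mem hy]
        have hyt' : 0 < t - y := sub_pos.2 hy.2
        have h3 : ∀ φ : Fin k → ℝ, G (Fin.cons y φ) = ENNReal.ofReal (y ^ (b 0 - 1)) *
            (scaledSimplex k (t - y)).indicator (fun φ => ENNReal.ofReal
              ((∏ i : Fin k, φ i ^ (b i.succ - 1)) * (t - y - ∑ i, φ i) ^ (c - 1))) φ := by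
          intro φ
          by_cases hφ : φ ∈ scaledSimplex k (t - y)
          · rw [hG, Set.indicator_of_mem hφ, Set.indicator_of_mem ((hmem φ).2 ⟨hy.1.le, hφ⟩),
              ← ENNReal.ofReal_mul (Real.rpow_nonneg hy.1.le _)]
            simp only [Fin.prod_univ_succ, Fin.sum_univ_succ, Fin.cons_zero, Fin.cons_succ,
              mul_assoc, sub_sub]
          · rw [hG, Set.indicator_of_notMem hφ,
              Set.indicator_of_notMem (fun h => hφ ((hmem φ).1 h).2), mul_zero]
        simp_rw [h3]
        rw [lintegral_const_mul _ ((by fun_prop : Measurable fun φ : Fin k → ℝ => ENNReal.ofReal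
              ((∏ i : Fin k, φ i ^ (b i.succ - 1)) * (t - y - ∑ i, φ i) ^ (c - 1))).indicator
              (measurableSet_scaledSimplex _ _)),
          lintegral_indicator (measurableSet_scaledSimplex _ _),
          ih (fun i => b i.succ) (fun i => hb _) hyt',
          ← ENNReal.ofReal_mul (Real.rpow_nonneg hy.1.le _), ← ENNReal.ofReal_mul hK0]
        congr 1
        rw [← hK]
        ring
      · rw [Set.indicator_of_notMem hy]
        have h3 : ∀ φ : Fin k → ℝ, G (Fin.cons y φ) = 0 := by
          intro φ
          refine Set.indicator_of_notMem (fun h => ?_) _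
          obtain ⟨h4, h5, h6⟩ := (hmem φ).1 h
          have h7 : 0 ≤ ∑ i, φ i := Finset.sum_nonneg fun i _ => h5 i
          exact hy ⟨lt_of_le_of_ne h4 hy0.symm, lt_of_le_of_ne (by linarith) hyt⟩
        simp [h3]
    rw [lintegral_congr_ae key, lintegral_indicator measurableSet_Ioo,
      lintegral_const_mul _ (by fun_prop),
      lintegral_beta_scaled (hb 0) (by linarith) ht, ← ENNReal.ofReal_mul hK0]
    congr 1
    rw [hK, ProbabilityTheory.beta, Fin.sum_univ_succ, Fin.prod_univ_succ, ← add_assoc]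
    field_simp

/-- The marginal likelihood of a memoryless string with symbol counts `a` under the
`Dirichlet(1/2, …, 1/2)` prior (the Krichevsky–Trofimov probability). -/
noncomputable def ktProb {m : ℕ} (a : Fin m → ℕ) : ℝ :=
  Real.Gamma ((m : ℝ) / 2) / Real.pi ^ ((m : ℝ) / 2) *
    ((∏ j, Real.Gamma (a j + 1 / 2)) / Real.Gamma (∑ j, (a j : ℝ) + (m : ℝ) / 2))

theorem ktProb_pos {m : ℕ} (hm : 0 < m) (a : Fin m → ℕ) : 0 < ktProb a := by
  have hm' : (0 : ℝ) < m := by exact_mod_cast hm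
  refine mul_pos (div_pos (Real.Gamma_pos_of_pos (by positivity)) (by positivity))
    (div_pos (Finset.prod_pos fun j _ => Real.Gamma_pos_of_pos (by positivity))
      (Real.Gamma_pos_of_pos (by positivity)))

theorem measurable_paramMap (m : ℕ) : Measurable (paramMap m) := by
  refine measurable_pi_lambda _ fun j => ?_
  unfold paramMap
  split_ifs <;> fun_prop

theorem paramMap_nonneg {m : ℕ} {φ : Fin (m - 1) → ℝ} (hφ : φ ∈ solidSimplex m) (j : Fin m) :
    0 ≤ paramMap m φ j := by
  unfold paramMap
  split_ifs with h
  · exact hφ.1 _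
  · linarith [hφ.2]

/-- Since `0 ^ x = 0` for real `x ≠ 0`, this holds on the boundary of the simplex too. -/
theorem rpow_neg_half_mul_pow {x : ℝ} (hx : 0 ≤ x) (a : ℕ) :
    x ^ (-(1 / 2 : ℝ)) * x ^ a = x ^ ((a + 1 / 2 : ℝ) - 1) := by
  rcases hx.eq_or_lt with rfl | hx
  · have h : ((a + 1 / 2 : ℝ) - 1) ≠ 0 := by
      intro h
      have h2 : (2 * a : ℝ) = 1 := by linarith
      have h3 : 2 * a = 1 := by exact_mod_cast h2
      omega
    rw [Real.zero_rpow h, Real.zero_rpow (by norm_num), zero_mul]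
  · rw [← Real.rpow_natCast, ← Real.rpow_add hx]
    congr 1
    ring

theorem measurableSet_solidSimplex (m : ℕ) : MeasurableSet (solidSimplex m) :=
  measurableSet_scaledSimplex (m - 1) 1

theorem lintegral_dirichletHalf {m : ℕ} (hm : 0 < m) (a : Fin m → ℕ) :
    ∫⁻ p, ENNReal.ofReal (∏ j, p j ^ a j) ∂(dirichletHalf m) = ENNReal.ofReal (ktProb a) := by
  have hm' : (0 : ℝ) < m := by exact_mod_cast hm
  have hc : 0 < Real.Gamma ((m : ℝ) / 2) / Real.pi ^ ((m : ℝ) / 2) :=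
    div_pos (Real.Gamma_pos_of_pos (by positivity)) (by positivity)
  have hpm := measurable_paramMap m
  have hpj : ∀ j, Measurable fun φ => paramMap m φ j := fun j => (measurable_pi_apply j).comp hpm
  rw [dirichletHalf, lintegral_map (by fun_prop) hpm,
    lintegral_withDensity_eq_lintegral_mul _ (by fun_prop) (by fun_prop)]
  have h1 : ∀ φ ∈ solidSimplex m,
      ENNReal.ofReal (Real.Gamma ((m : ℝ) / 2) / Real.pi ^ ((m : ℝ) / 2) *
        ∏ j : Fin m, paramMap m φ j ^ (-(1 / 2 : ℝ))) *
        ENNReal.ofReal (∏ j, paramMap m φ j ^ a j) =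
      ENNReal.ofReal (Real.Gamma ((m : ℝ) / 2) / Real.pi ^ ((m : ℝ) / 2)) *
        ENNReal.ofReal (∏ j, paramMap m φ j ^ ((a j + 1 / 2 : ℝ) - 1)) := by
    intro φ hφ
    rw [← ENNReal.ofReal_mul hc.le, ← ENNReal.ofReal_mul (mul_nonneg hc.le
      (Finset.prod_nonneg fun j _ => Real.rpow_nonneg (paramMap_nonneg hφ j) _)), mul_assoc,
      ← Finset.prod_mul_distrib]
    congr 2
    exact Finset.prod_congr rfl fun j _ => rpow_neg_half_mul_pow (paramMap_nonneg hφ j) _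
  simp only [Pi.mul_apply]
  rw [setLIntegral_congr_fun (measurableSet_solidSimplex m) h1,
    lintegral_const_mul _ (by fun_prop)]
  obtain ⟨k, rfl⟩ : ∃ k, m = k + 1 := ⟨m - 1, by omega⟩
  have h2 := lintegral_dirichlet k (fun i => (a i.castSucc + 1 / 2 : ℝ)) (fun i => by positivity)
    (c := (a (Fin.last k) + 1 / 2 : ℝ)) (t := 1) (by positivity) one_pos
  have h3 : ∀ φ : Fin k → ℝ, ∏ j, paramMap (k + 1) φ j ^ ((a j + 1 / 2 : ℝ) - 1) =
      (∏ i : Fin k, φ i ^ ((a i.castSucc + 1 / 2 : ℝ) - 1)) *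
        (1 - ∑ i, φ i) ^ ((a (Fin.last k) + 1 / 2 : ℝ) - 1) := by
    intro φ
    rw [Fin.prod_univ_castSucc]
    simp [paramMap]
  change _ * ∫⁻ φ in scaledSimplex k 1,
    ENNReal.ofReal (∏ j, paramMap (k + 1) φ j ^ ((a j + 1 / 2 : ℝ) - 1)) = _
  simp_rw [h3]
  rw [h2, ← ENNReal.ofReal_mul hc.le, ktProb, Fin.prod_univ_castSucc, Fin.sum_univ_castSucc,
    Real.one_rpow, one_mul, Finset.sum_add_distrib]
  congr 4
  simp
  ring

instance isFiniteMeasure_dirichletHalf (m : ℕ) [NeZero m] : IsFiniteMeasure (dirichletHalf m) := by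
  refine ⟨?_⟩
  have h := lintegral_dirichletHalf (Nat.pos_of_ne_zero (NeZero.ne m)) (fun _ : Fin m => 0)
  simp only [pow_zero, Finset.prod_const_one, ENNReal.ofReal_one, lintegral_one] at h
  rw [h]
  exact ENNReal.ofReal_lt_top

theorem dirichletHalf_nonneg (m : ℕ) : ∀ᵐ p ∂(dirichletHalf m), ∀ j, 0 ≤ p j := by
  rw [dirichletHalf, ae_map_iff (measurable_paramMap m).aemeasurable
    (by rw [Set.ofPred_forall]
        exact MeasurableSet.iInter fun i => measurableSet_le (by fun_prop) (by fun_prop))]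
  refine (withDensity_absolutelyContinuous _ _).ae_le ?_
  filter_upwards [ae_restrict_mem (measurableSet_solidSimplex m)] with φ hφ j
  exact paramMap_nonneg hφ j

theorem integral_dirichletHalf {m : ℕ} (hm : 0 < m) (a : Fin m → ℕ) :
    ∫ p, ∏ j, p j ^ a j ∂(dirichletHalf m) = ktProb a := by
  rw [integral_eq_lintegral_of_nonneg_ae, lintegral_dirichletHalf hm,
    ENNReal.toReal_ofReal (ktProb_pos hm a).le]
  · filter_upwards [dirichletHalf_nonneg m] with p hp
    exact Finset.prod_nonneg fun j _ => pow_nonneg (hp j) _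
  · exact (by fun_prop : Measurable fun p : Fin m → ℝ => ∏ j, p j ^ a j).aestronglyMeasurable

theorem marginalLikelihood_eq {m : ℕ} (hm : 0 < m) (D : ℕ) (T : Finset (List (Fin m)))
    (x : ℕ → Fin m) (n : ℕ) :
    marginalLikelihood D T x n = ∏ s ∈ T, ktProb (count D x n s) := by
  have : NeZero m := ⟨hm.ne'⟩
  unfold marginalLikelihood likelihood paramPrior
  rw [integral_fintype_prod_eq_prod (fun (s : T) (p : Fin m → ℝ) => ∏ j, p j ^ count D x n s j)]
  simp_rw [integral_dirichletHalf hm]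
  exact Finset.prod_coe_sort T (fun s => ktProb (count D x n s))

/-! ### Stirling bounds for the Krichevsky–Trofimov probability -/

theorem exists_log_factorial_bound :
    ∃ C : ℝ, ∀ n : ℕ, 1 ≤ n →
      |Real.log (n.factorial) - (n * Real.log n - n + 1 / 2 * Real.log n)| ≤ C := by
  obtain ⟨a, ha, hle⟩ := Stirling.stirlingSeq'_bounded_by_pos_constant
  refine ⟨|Real.log a| + |Real.log (Stirling.stirlingSeq 1)| + |1 / 2 * Real.log 2|,
    fun n hn => ?_⟩
  obtain ⟨k, rfl⟩ : ∃ k, n = k + 1 := ⟨n - 1, by omega⟩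
  have h1 := Stirling.log_stirlingSeq_formula (k + 1)
  have hpos : (0 : ℝ) < ((k + 1 : ℕ) : ℝ) := by positivity
  rw [Real.log_mul two_ne_zero hpos.ne', Real.log_div hpos.ne' (Real.exp_pos 1).ne',
    Real.log_exp] at h1
  have h2 : Real.log a ≤ Real.log (Stirling.stirlingSeq (k + 1)) := Real.log_le_log ha (hle k)
  have h3 : Real.log (Stirling.stirlingSeq (k + 1)) ≤ Real.log (Stirling.stirlingSeq 1) :=
    Real.log_le_log (Stirling.stirlingSeq'_pos k) (Stirling.stirlingSeq'_antitone (Nat.zero_le k))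
  have h4 := neg_abs_le (Real.log a)
  have h5 := le_abs_self (Real.log (Stirling.stirlingSeq 1))
  have h6 := neg_abs_le (1 / 2 * Real.log 2)
  have h7 := le_abs_self (1 / 2 * Real.log 2)
  have h8 := abs_nonneg (Real.log a)
  have h9 := abs_nonneg (Real.log (Stirling.stirlingSeq 1))
  rw [abs_le]
  constructor <;> linarith

theorem log_Gamma_add_one {x : ℝ} (hx : 0 < x) :
    Real.log (Real.Gamma (x + 1)) = Real.log x + Real.log (Real.Gamma x) := by
  rw [Real.Gamma_add_one hx.ne', Real.log_mul hx.ne' (Real.Gamma_pos_of_pos hx).ne']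

theorem log_Gamma_add_half_le {x : ℝ} (hx : 0 < x) :
    Real.log (Real.Gamma (x + 1 / 2)) ≤ Real.log (Real.Gamma x) + 1 / 2 * Real.log x := by
  have h := Real.convexOn_log_Gamma.2 (Set.mem_Ioi.2 hx)
    (Set.mem_Ioi.2 (by positivity : 0 < x + 1))
    (by norm_num : (0 : ℝ) ≤ 1 / 2) (by norm_num : (0 : ℝ) ≤ 1 / 2) (by norm_num)
  simp only [Function.comp, smul_eq_mul] at h
  rw [log_Gamma_add_one hx, show 1 / 2 * x + 1 / 2 * (x + 1) = x + 1 / 2 by ring] at h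
  linarith

/-- Log-convexity of `Γ` interpolates between the factorials, for which Stirling's formula is
available; the recurrence `Γ (x + 1) = x Γ x` does the rest. -/
theorem exists_log_Gamma_bound (m : ℕ) :
    ∃ C : ℝ, ∀ M : ℕ, 1 ≤ M → |Real.log (Real.Gamma (M + (m : ℝ) / 2)) -
      (M * Real.log M - M + ((m : ℝ) - 1) / 2 * Real.log M)| ≤ C := by
  induction m using Nat.twoStepInduction with
  | zero =>
    obtain ⟨C, hC⟩ := exists_log_factorial_bound
    refine ⟨C, fun M hM => ?_⟩
    have hpos : (0 : ℝ) < M := by exact_mod_cast hM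
    have h := hC M hM
    rw [← Real.Gamma_nat_eq_factorial, log_Gamma_add_one hpos] at h
    simp only [Nat.cast_zero, zero_div, add_zero]
    convert h using 2
    ring
  | one =>
    obtain ⟨C, hC⟩ := exists_log_factorial_bound
    refine ⟨C + Real.log 2, fun M hM => ?_⟩
    have hpos : (0 : ℝ) < M := by exact_mod_cast hM
    have hM1 : (1 : ℝ) ≤ M := by exact_mod_cast hM
    have h := hC M hM
    rw [← Real.Gamma_nat_eq_factorial] at h
    have h1 := log_Gamma_add_half_le hpos
    have h2 := log_Gamma_add_half_le (x := M + 1 / 2) (by positivity)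
    rw [show (M : ℝ) + 1 / 2 + 1 / 2 = M + 1 by ring] at h2
    have h3 : Real.log (M + 1 / 2) ≤ Real.log 2 + Real.log M := by
      rw [← Real.log_mul two_ne_zero hpos.ne']
      exact Real.log_le_log (by positivity) (by linarith)
    have h4 := log_Gamma_add_one hpos
    have h5 := Real.log_nonneg one_le_two
    rw [abs_le] at h ⊢
    simp only [Nat.cast_one, sub_self, zero_div, zero_mul, add_zero]
    constructor <;> linarith [h.1, h.2]
  | more m ih _ =>
    obtain ⟨C, hC⟩ := ih
    refine ⟨C + Real.log (1 + (m : ℝ) / 2), fun M hM => ?_⟩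
    have hpos : (0 : ℝ) < M := by exact_mod_cast hM
    have hM1 : (1 : ℝ) ≤ M := by exact_mod_cast hM
    have h := hC M hM
    have h1 := log_Gamma_add_one (x := M + (m : ℝ) / 2) (by positivity)
    have h2 : (M : ℝ) + ((m + 1 + 1 : ℕ) : ℝ) / 2 = M + (m : ℝ) / 2 + 1 := by
      push_cast
      ring
    have h3 : Real.log (M + (m : ℝ) / 2) ≤ Real.log (1 + (m : ℝ) / 2) + Real.log M := by
      rw [← Real.log_mul (by positivity) hpos.ne']
      refine Real.log_le_log (by positivity) ?_
      have : (0 : ℝ) ≤ (m : ℝ) / 2 := by positivity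
      nlinarith
    have h4 : Real.log M ≤ Real.log (M + (m : ℝ) / 2) :=
      Real.log_le_log hpos (by linarith [show (0 : ℝ) ≤ (m : ℝ) / 2 by positivity])
    have h5 : 0 ≤ Real.log (1 + (m : ℝ) / 2) :=
      Real.log_nonneg (by linarith [show (0 : ℝ) ≤ (m : ℝ) / 2 by positivity])
    rw [h2, h1]
    push_cast
    rw [abs_le] at h ⊢
    constructor <;> linarith [h.1, h.2]

/-- The maximum over all probability vectors of the log-likelihood of a memoryless string with
symbol counts `a`. -/
noncomputable def maxLogLik {m : ℕ} (a : Fin m → ℕ) : ℝ :=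
  ∑ j, a j * Real.log (a j / ∑ i, (a i : ℝ))

/-- The bound is uniform over all counts, including those that vanish. -/
theorem exists_log_ktProb_bound {m : ℕ} (hm : 0 < m) :
    ∃ C : ℝ, ∀ a : Fin m → ℕ, 1 ≤ ∑ j, a j → |Real.log (ktProb a) -
      (maxLogLik a - ((m : ℝ) - 1) / 2 * Real.log (∑ j, a j : ℕ))| ≤ C := by
  obtain ⟨C₁, hC₁⟩ := exists_log_Gamma_bound 1
  obtain ⟨C₂, hC₂⟩ := exists_log_Gamma_bound m
  have hm' : (0 : ℝ) < m := by exact_mod_cast hm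
  set c := Real.Gamma ((m : ℝ) / 2) / Real.pi ^ ((m : ℝ) / 2) with hc
  have hc0 : 0 < c := div_pos (Real.Gamma_pos_of_pos (by positivity)) (by positivity)
  set B := |C₁| + |Real.log (Real.Gamma (1 / 2))| with hB
  refine ⟨|Real.log c| + m * B + C₂, fun a ha => ?_⟩
  have hM : (0 : ℝ) < (∑ j, a j : ℕ) := by exact_mod_cast ha
  have h1 : ∀ j, |Real.log (Real.Gamma (a j + 1 / 2)) - (a j * Real.log (a j) - a j)| ≤ B := by
    intro j
    -- A count that vanishes contributes the constant `Γ(1/2)`.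
    rcases Nat.eq_zero_or_pos (a j) with h0 | h0
    · rw [h0]
      simp only [Nat.cast_zero, zero_mul, sub_zero, zero_add]
      exact le_add_of_nonneg_left (abs_nonneg _)
    · have h := hC₁ (a j) h0
      simp only [Nat.cast_one, sub_self, zero_div, zero_mul, add_zero] at h
      exact h.trans ((le_abs_self _).trans (le_add_of_nonneg_right (abs_nonneg _)))
  have h2 : |∑ j, (Real.log (Real.Gamma (a j + 1 / 2)) - (a j * Real.log (a j) - a j))|
      ≤ m * B := by
    refine (Finset.abs_sum_le_sum_abs _ _).trans ((Finset.sum_le_sum fun j _ => h1 j).trans ?_)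
    simp
  have h3 := hC₂ (∑ j, a j) ha
  have h4 : maxLogLik a =
      ∑ j, (a j : ℝ) * Real.log (a j) - (∑ j, a j : ℕ) * Real.log (∑ j, a j : ℕ) := by
    have : ∀ j, (a j : ℝ) * Real.log (a j / ∑ i, (a i : ℝ)) =
        a j * Real.log (a j) - a j * Real.log (∑ i, a i : ℕ) := by
      intro j
      rcases Nat.eq_zero_or_pos (a j) with h0 | h0
      · simp [h0]
      · have h5 : (0 : ℝ) < a j := by exact_mod_cast h0
        rw [← Nat.cast_sum, Real.log_div h5.ne' hM.ne']
        ring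
    unfold maxLogLik
    rw [Finset.sum_congr rfl fun j _ => this j, Finset.sum_sub_distrib, ← Finset.sum_mul,
      ← Nat.cast_sum]
  have h5 : Real.log (ktProb a) = Real.log c + ∑ j, Real.log (Real.Gamma (a j + 1 / 2)) -
      Real.log (Real.Gamma ((∑ j, a j : ℕ) + (m : ℝ) / 2)) := by
    have hp : ∀ j ∈ Finset.univ, Real.Gamma ((a j : ℝ) + 1 / 2) ≠ 0 := fun j _ =>
      (Real.Gamma_pos_of_pos (by positivity)).ne'
    have hs : Real.Gamma (((∑ j, a j : ℕ) : ℝ) + (m : ℝ) / 2) ≠ 0 :=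
      (Real.Gamma_pos_of_pos (by positivity)).ne'
    rw [ktProb, ← hc, ← Nat.cast_sum, Real.log_mul hc0.ne'
      (div_ne_zero (Finset.prod_ne_zero_iff.2 hp) hs), Real.log_div
      (Finset.prod_ne_zero_iff.2 hp) hs, Real.log_prod hp]
    ring
  rw [Finset.sum_sub_distrib, Finset.sum_sub_distrib, ← Nat.cast_sum] at h2
  have h6 := le_abs_self (Real.log c)
  have h7 := neg_abs_le (Real.log c)
  rw [h4, h5]
  rw [abs_le] at h2 h3 ⊢
  constructor <;> linarith [h2.1, h2.2, h3.1, h3.2]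

/-! ### Inequalities between log-likelihoods -/

/-- Gibbs' inequality with a quadratic remainder; it follows from `log x ≤ 2 (√x - 1)`, which
bounds the divergence below by the squared Hellinger distance. -/
theorem sum_mul_log_le {ι : Type*} [Fintype ι] {p q : ι → ℝ} (hp : ∀ j, 0 ≤ p j)
    (hq : ∀ j, 0 ≤ q j) (hp1 : ∑ j, p j = 1) (hq1 : ∑ j, q j = 1)
    (hpq : ∀ j, q j = 0 → p j = 0) :
    ∑ j, p j * Real.log (q j) ≤
      ∑ j, p j * Real.log (p j) - 1 / 4 * ∑ j, (p j - q j) ^ 2 := by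
  have hle1 : ∀ {f : ι → ℝ}, (∀ j, 0 ≤ f j) → ∑ j, f j = 1 → ∀ j, f j ≤ 1 := fun h0 h1 j =>
    h1 ▸ Finset.single_le_sum (fun i _ => h0 i) (Finset.mem_univ j)
  have key : ∀ j, p j * Real.log (q j) - p j * Real.log (p j) ≤
      q j - p j - 1 / 4 * (p j - q j) ^ 2 := by
    intro j
    have hs := Real.sq_sqrt (hp j)
    have ht := Real.sq_sqrt (hq j)
    set s := Real.sqrt (p j)
    set t := Real.sqrt (q j)
    have hs0 : 0 ≤ s := Real.sqrt_nonneg _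
    have ht0 : 0 ≤ t := Real.sqrt_nonneg _
    have hs1 : s ≤ 1 := by nlinarith [hle1 hp hp1 j]
    have ht1 : t ≤ 1 := by nlinarith [hle1 hq hq1 j]
    have h1 : p j * Real.log (q j) - p j * Real.log (p j) ≤ q j - p j - (s - t) ^ 2 := by
      rcases hs0.eq_or_lt with h0 | h0
      · rw [← h0] at hs ⊢
        rw [← hs]
        nlinarith
      · have hpj : 0 < p j := by rw [← hs]; positivity
        have htpos : 0 < t := by
          refine lt_of_le_of_ne ht0 fun h => hpj.ne' (hpq j ?_)
          rw [← ht, ← h]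
          norm_num
        have h2 : Real.log (q j) - Real.log (p j) ≤ 2 * (t / s - 1) := by
          rw [← hs, ← ht, Real.log_pow, Real.log_pow]
          have := Real.log_le_sub_one_of_pos (div_pos htpos h0)
          rw [Real.log_div htpos.ne' h0.ne'] at this
          push_cast
          linarith
        calc _ = p j * (Real.log (q j) - Real.log (p j)) := by ring
          _ ≤ p j * (2 * (t / s - 1)) := mul_le_mul_of_nonneg_left h2 hpj.le
          _ = _ := by
            rw [← hs, ← ht]
            field_simp
            ring
    have h3 : (p j - q j) ^ 2 ≤ 4 * (s - t) ^ 2 := by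
      rw [← hs, ← ht]
      have : (s ^ 2 - t ^ 2) ^ 2 = (s + t) ^ 2 * (s - t) ^ 2 := by ring
      rw [this]
      exact mul_le_mul_of_nonneg_right (by nlinarith) (sq_nonneg _)
    linarith
  have h := Finset.sum_le_sum fun j (_ : j ∈ Finset.univ) => key j
  rw [Finset.sum_sub_distrib, Finset.sum_sub_distrib, Finset.sum_sub_distrib, hp1, hq1,
    ← Finset.mul_sum] at h
  linarith

/-- The log-likelihood at `q` of a string with counts `a` falls short of its maximum by a
quadratic amount. -/
theorem logLik_le_maxLogLik_sub {m : ℕ} {a : Fin m → ℕ} {q : Fin m → ℝ} (hq : ∀ j, 0 ≤ q j)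
    (hq1 : ∑ j, q j = 1) (haq : ∀ j, q j = 0 → a j = 0) :
    ∑ j, a j * Real.log (q j) ≤ maxLogLik a -
      1 / 4 * (∑ j, (a j : ℝ)) * ∑ j, (a j / (∑ i, (a i : ℝ)) - q j) ^ 2 := by
  set M := ∑ j, (a j : ℝ) with hM
  have hM0 : 0 ≤ M := Finset.sum_nonneg fun j _ => Nat.cast_nonneg (a j)
  rcases hM0.eq_or_lt with h0 | h0
  · have : ∀ j, (a j : ℝ) = 0 := fun j => (Finset.sum_eq_zero_iff_of_nonneg
      fun j _ => Nat.cast_nonneg (a j)).1 (hM.symm.trans h0.symm) j (Finset.mem_univ j)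
    simp [maxLogLik, this, ← h0]
  · have h := sum_mul_log_le (p := fun j => a j / M) (fun j => by positivity) hq
      (by rw [← Finset.sum_div, ← hM, div_self h0.ne']) hq1 (fun j hj => by simp [haq j hj])
    have h2 := mul_le_mul_of_nonneg_left h h0.le
    rw [mul_sub, Finset.mul_sum, Finset.mul_sum] at h2
    have h3 : ∀ x y : ℝ, M * (x / M * y) = x * y := fun x y => by field_simp
    simp only [h3] at h2
    rw [maxLogLik, ← hM]
    linarith

theorem logLik_le_maxLogLik {m : ℕ} {a : Fin m → ℕ} {q : Fin m → ℝ} (hq : ∀ j, 0 ≤ q j)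
    (hq1 : ∑ j, q j = 1) (haq : ∀ j, q j = 0 → a j = 0) :
    ∑ j, a j * Real.log (q j) ≤ maxLogLik a := by
  refine (logLik_le_maxLogLik_sub hq hq1 haq).trans (sub_le_self _ ?_)
  positivity

/-- The log-likelihood at the maximum exceeds that at `q` by at most the `χ²` statistic. -/
theorem maxLogLik_le_logLik_add {m : ℕ} {a : Fin m → ℕ} {q : Fin m → ℝ} (hq : ∀ j, 0 ≤ q j)
    (hq1 : ∑ j, q j = 1) (haq : ∀ j, q j = 0 → a j = 0) :
    maxLogLik a ≤ ∑ j, a j * Real.log (q j) +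
      ∑ j, (a j - (∑ i, (a i : ℝ)) * q j) ^ 2 / ((∑ i, (a i : ℝ)) * q j) := by
  unfold maxLogLik
  set M := ∑ j, (a j : ℝ) with hM
  have hM0 : 0 ≤ M := Finset.sum_nonneg fun j _ => Nat.cast_nonneg (a j)
  rcases hM0.eq_or_lt with h0 | h0
  · have : ∀ j, (a j : ℝ) = 0 := fun j => (Finset.sum_eq_zero_iff_of_nonneg
      fun j _ => Nat.cast_nonneg (a j)).1 (hM.symm.trans h0.symm) j (Finset.mem_univ j)
    simp [this, ← h0]
  · have key : ∀ j, a j * Real.log (a j / M) ≤ a j * Real.log (q j) +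
        (a j - M * q j) ^ 2 / (M * q j) + (a j - M * q j) := by
      intro j
      rcases (hq j).eq_or_lt with hj | hj
      · simp [haq j hj.symm, ← hj]
      · rcases (Nat.cast_nonneg (a j) : (0 : ℝ) ≤ a j).eq_or_lt with h1 | h1
        · rw [← h1]
          have h2 := mul_pos h0 hj
          field_simp
          linarith
        · have h2 := mul_pos h0 hj
          have h3 := Real.log_le_sub_one_of_pos (div_pos h1 h2)
          rw [Real.log_div h1.ne' h2.ne', Real.log_mul h0.ne' hj.ne'] at h3
          rw [Real.log_div h1.ne' h0.ne']
          have h4 := mul_le_mul_of_nonneg_left h3 h1.le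
          have h5 : (a j - M * q j) ^ 2 / (M * q j) + (a j - M * q j) =
              a j * (a j / (M * q j) - 1) := by
            field_simp
            ring
          linarith
    have h := Finset.sum_le_sum fun j (_ : j ∈ Finset.univ) => key j
    rw [Finset.sum_add_distrib, Finset.sum_add_distrib, Finset.sum_sub_distrib,
      ← Finset.mul_sum, hq1, ← hM] at h
    linarith

/-! ### Superharmonic path functionals -/

section Paths

variable {Ω : Type*} {m : ℕ}

/-- The event that the first `N` symbols of the process `X` agree with the word `w`. -/
def cylinder (X : ℕ → Ω → Fin m) (N : ℕ) (w : ℕ → Fin m) : Set Ω :=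
  {ω | ∀ k < N, X k ω = w k}

theorem measurableSet_cylinder [MeasurableSpace Ω] {X : ℕ → Ω → Fin m} (hX : ∀ k, Measurable (X k))
    (N : ℕ) (w : ℕ → Fin m) : MeasurableSet (cylinder X N w) := by
  have : cylinder X N w = ⋂ k, ⋂ _ : k < N, X k ⁻¹' {w k} := by
    ext ω
    simp [cylinder]
  rw [this]
  exact MeasurableSet.iInter fun k => MeasurableSet.iInter fun _ =>
    hX k (MeasurableSet.singleton _)

/-- The first `N` symbols of the process. -/
def initialSegment (X : ℕ → Ω → Fin m) (N : ℕ) (ω : Ω) : Fin N → Fin m := fun k => X k ω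

theorem measurable_initialSegment [MeasurableSpace Ω] {X : ℕ → Ω → Fin m}
    (hX : ∀ k, Measurable (X k)) (N : ℕ) : Measurable (initialSegment X N) :=
  measurable_pi_lambda _ fun k => hX k

/-- The filtration generated by the symbols; at time `n` the initial context and `n` observations
are known. -/
def symbolFiltration [MeasurableSpace Ω] {X : ℕ → Ω → Fin m} (hX : ∀ k, Measurable (X k)) (D : ℕ) :
    Filtration ℕ (inferInstance : MeasurableSpace Ω) where
  seq n := MeasurableSpace.comap (initialSegment X (D + n)) inferInstance
  mono' := by
    intro i j hij
    have hij' : D + i ≤ D + j := by omega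
    have : initialSegment X (D + i) =
        (fun (v : Fin (D + j) → Fin m) (k : Fin (D + i)) => v (Fin.castLE hij' k)) ∘
          initialSegment X (D + j) := rfl
    dsimp only
    rw [this, ← MeasurableSpace.comap_comp]
    exact MeasurableSpace.comap_mono (Measurable.comap_le
      (measurable_pi_lambda _ fun k => measurable_pi_apply _))
  le' n := (measurable_initialSegment hX _).comap_le

/-- An arbitrary extension of a finite word to an infinite sequence. -/
def extendWord [NeZero m] {N : ℕ} (v : Fin N → Fin m) (k : ℕ) : Fin m :=
  if h : k < N then v ⟨k, h⟩ else 0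

theorem cylinder_extendWord [NeZero m] (X : ℕ → Ω → Fin m) {N : ℕ} (v : Fin N → Fin m) :
    cylinder X N (extendWord v) = initialSegment X N ⁻¹' {v} := by
  ext ω
  simp only [cylinder, Set.mem_ofPred_eq, Set.mem_preimage, Set.mem_singleton_iff, funext_iff,
    initialSegment]
  constructor
  · intro h k
    rw [h k k.2]
    simp [extendWord]
  · intro h k hk
    have := h ⟨k, hk⟩
    simpa [extendWord, hk] using this

theorem cylinder_eq_iUnion_update (X : ℕ → Ω → Fin m) (N : ℕ) (w : ℕ → Fin m) :
    cylinder X N w = ⋃ j, cylinder X (N + 1) (Function.update w N j) := by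
  ext ω
  simp only [cylinder, Set.mem_iUnion, Set.mem_ofPred_eq]
  constructor
  · intro h
    refine ⟨X N ω, fun k hk => ?_⟩
    rcases Nat.lt_succ_iff_lt_or_eq.1 hk with hk | rfl
    · rw [Function.update_of_ne hk.ne, h k hk]
    · simp
  · rintro ⟨j, h⟩ k hk
    rw [h k (by omega), Function.update_of_ne hk.ne]

theorem window_congr {D n : ℕ} {x y : ℕ → Fin m} (h : ∀ k < D + n, x k = y k) :
    window D x n = window D y n := by
  funext k
  exact h _ (by omega)

variable [MeasurableSpace Ω] {μ : Measure Ω} {D : ℕ} {T : Finset (List (Fin m))}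
  {θ : T → Fin m → ℝ} {X : ℕ → Ω → Fin m}

/-- A nonnegative functional of the path that does not increase on average under the transition
probabilities of the chain is a nonnegative supermartingale, hence almost surely bounded. -/
theorem ae_bounded_of_superharmonic [IsProbabilityMeasure μ] [NeZero m]
    (hX : IsVariableMemoryChain μ D T θ X) (hp : ∀ z j, 0 ≤ condProb (D := D) T θ z j)
    {F : ℕ → (ℕ → Fin m) → ℝ} (hF0 : ∀ n x, 0 ≤ F n x)
    (hdep : ∀ n x y, (∀ k < D + n, x k = y k) → F n x = F n y)
    (hstep : ∀ n x, ∑ j, condProb T θ (window D x n) j * F (n + 1) (Function.update x (D + n) j)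
      ≤ F n x) :
    ∀ᵐ ω ∂μ, ∃ C, ∀ n, F n (fun k => X k ω) ≤ C := by
  have hm := hX.measurable
  set f : ℕ → Ω → ℝ := fun n ω => F n fun k => X k ω with hf
  have hfG : ∀ n, f n = (fun v => F n (extendWord v)) ∘ initialSegment X (D + n) := by
    intro n
    funext ω
    refine hdep n _ _ fun k hk => ?_
    simp [extendWord, hk, initialSegment]
  have hint : ∀ n, Integrable (f n) μ := by
    intro n
    rw [hfG n]
    exact Integrable.of_finite.comp_measurable (measurable_initialSegment hm _)
  have hconst : ∀ n w, ∫ ω in cylinder X (D + n) w, f n ω ∂μ =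
      μ.real (cylinder X (D + n) w) * F n w := by
    intro n w
    rw [setIntegral_congr_fun (measurableSet_cylinder hm _ _)
      (fun ω hω => hdep n (fun k => X k ω) w hω), setIntegral_const, smul_eq_mul]
  have hcyl : ∀ n w, ∫ ω in cylinder X (D + n) w, f (n + 1) ω ∂μ ≤
      ∫ ω in cylinder X (D + n) w, f n ω ∂μ := by
    intro n w
    rw [hconst, cylinder_eq_iUnion_update X (D + n) w,
      integral_iUnion_fintype (fun j => measurableSet_cylinder hm _ _) ?_
        (fun j => (hint _).integrableOn), ← cylinder_eq_iUnion_update X (D + n) w]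
    · have h1 : ∀ j, μ.real (cylinder X (D + n + 1) (Function.update w (D + n) j)) =
          μ.real (cylinder X (D + n) w) * condProb T θ (window D w n) j := by
        intro j
        have hw : ∀ k < D + n, Function.update w (D + n) j k = w k := fun k hk =>
          Function.update_of_ne hk.ne _ _
        have h2 := hX.step n (Function.update w (D + n) j)
        rw [window_congr hw, Function.update_self] at h2
        have h3 : {ω | ∀ k < D + n, X k ω = Function.update w (D + n) j k} =
            cylinder X (D + n) w := by
          ext ω
          exact forall₂_congr fun k hk => by rw [hw k hk]
        rw [h3] at h2
        rw [Measure.real, cylinder, h2, ENNReal.toReal_mul, ENNReal.toReal_ofReal (hp _ _),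
          Measure.real]
      have h4 : ∀ j, ∫ ω in cylinder X (D + n + 1) (Function.update w (D + n) j), f (n + 1) ω ∂μ
          = μ.real (cylinder X (D + n) w) * (condProb T θ (window D w n) j *
            F (n + 1) (Function.update w (D + n) j)) := by
        intro j
        rw [← mul_assoc, ← h1]
        exact hconst (n + 1) _
      simp_rw [h4, ← Finset.mul_sum]
      exact mul_le_mul_of_nonneg_left (hstep n w) measureReal_nonneg
    · intro i j hij
      refine Set.disjoint_left.2 fun ω hi hj => hij ?_
      have h1 := hi (D + n) (by omega)
      have h2 := hj (D + n) (by omega)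
      simp only [Function.update_self] at h1 h2
      exact h1.symm.trans h2
  have hsup : Supermartingale f (symbolFiltration hm D) μ := by
    refine supermartingale_of_setIntegral_succ_le (fun n => ?_) hint fun n s hs => ?_
    · rw [hfG n]
      exact ((measurable_of_finite _).comp (comap_measurable _)).stronglyMeasurable
    · obtain ⟨S, -, rfl⟩ := hs
      have h1 : initialSegment X (D + n) ⁻¹' S =
          ⋃ v ∈ S.toFinite.toFinset, cylinder X (D + n) (extendWord v) := by
        ext ω
        simp [cylinder_extendWord]
      have h2 : ((S.toFinite.toFinset : Set (Fin (D + n) → Fin m))).Pairwise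
          (Function.onFun Disjoint fun v => cylinder X (D + n) (extendWord v)) := by
        intro v _ w _ hvw
        simp only [Function.onFun, cylinder_extendWord]
        exact Disjoint.preimage _ (Set.disjoint_singleton.2 hvw)
      rw [h1, integral_biUnion_finset _ (fun v _ => measurableSet_cylinder hm _ _) h2
          (fun v _ => (hint _).integrableOn),
        integral_biUnion_finset _ (fun v _ => measurableSet_cylinder hm _ _) h2
          (fun v _ => (hint _).integrableOn)]
      exact Finset.sum_le_sum fun v _ => hcyl n _
  have hbdd : ∀ n, eLpNorm ((-f) n) 1 μ ≤ (∫ ω, f 0 ω ∂μ).toNNReal := by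
    intro n
    rw [Pi.neg_apply, eLpNorm_neg, eLpNorm_one_eq_lintegral_enorm,
      ← ofReal_integral_norm_eq_lintegral_enorm (hint n)]
    refine ENNReal.ofReal_le_ofReal ?_
    have h1 := hsup.setIntegral_le (Nat.zero_le n) (MeasurableSet.univ)
    simp only [setIntegral_univ] at h1
    refine le_trans (le_of_eq (integral_congr_ae (Eventually.of_forall fun ω => ?_))) h1
    exact abs_of_nonneg (hF0 _ _)
  filter_upwards [hsup.neg.exists_ae_tendsto_of_bdd hbdd] with ω ⟨c, hc⟩
  obtain ⟨B, hB⟩ := hc.bddBelow_range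
  refine ⟨-B, fun n => ?_⟩
  have := hB ⟨n, rfl⟩
  simp only [Pi.neg_apply] at this
  linarith

/-- Symbols with conditional probability zero almost surely do not occur. -/
theorem ae_condProb_ne_zero [NeZero m] (hX : IsVariableMemoryChain μ D T θ X) :
    ∀ᵐ ω ∂μ, ∀ n, condProb T θ (window D (fun k => X k ω) n) (X (D + n) ω) ≠ 0 := by
  rw [ae_all_iff]
  intro n
  have h1 : {ω | ¬ condProb T θ (window D (fun k => X k ω) n) (X (D + n) ω) ≠ 0} ⊆
      ⋃ v ∈ {v : Fin (D + n + 1) → Fin m |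
        condProb T θ (window D (extendWord v) n) (extendWord v (D + n)) = 0},
        cylinder X (D + n + 1) (extendWord v) := by
    intro ω hω
    simp only [Set.mem_ofPred_eq, not_not, ne_eq] at hω
    have h2 : ∀ k < D + n + 1, X k ω = extendWord (initialSegment X (D + n + 1) ω) k := by
      intro k hk
      simp [extendWord, hk, initialSegment]
    simp only [Set.mem_iUnion]
    refine ⟨initialSegment X (D + n + 1) ω, ?_, fun k hk => h2 k hk⟩
    rw [Set.mem_ofPred_eq, ← h2 _ (by omega), ← hω]
    congr 1
    exact window_congr fun k hk => (h2 k (by omega)).symm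
  refine measure_mono_null h1 ((measure_biUnion_null_iff (Set.to_countable _)).2 fun v hv => ?_)
  have h3 := hX.step n (extendWord v)
  rw [show condProb T θ (window D (extendWord v) n) (extendWord v (D + n)) = 0 from hv] at h3
  rw [ENNReal.ofReal_zero, mul_zero] at h3
  exact h3

end Paths

/-! ### Leaves of proper trees -/

section Trees

variable {m D : ℕ} {T : Finset (List (Fin m))}

theorem IsProperTree.eq_of_prefix (hT : IsProperTree T) {s t w : List (Fin m)} (hs : s ∈ T)
    (ht : t ∈ T) (hsw : s <+: w) (htw : t <+: w) : s = t := by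
  rcases List.prefix_or_prefix_of_prefix hsw htw with h | h
  · exact hT.prefix_free s hs t ht h
  · exact (hT.prefix_free t ht s hs h).symm

/-- Every word at least as long as the depth of the tree extends a leaf. -/
theorem exists_leaf_prefix (hT : T ∈ models m D) {w : List (Fin m)} (hw : D ≤ w.length) :
    ∃ s ∈ T, s <+: w := by
  obtain ⟨hP, hD⟩ := mem_models.1 hT
  by_contra! hno
  have key : ∀ k ≤ w.length, ∃ s ∈ T, w.take k <+: s := by
    intro k
    induction k with
    | zero =>
      intro _
      obtain ⟨s, hs⟩ := hP.nonempty
      exact ⟨s, hs, by simp⟩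
    | succ k ih =>
      intro hk
      obtain ⟨s, hs, hks⟩ := ih (by omega)
      have hne : w.take k ≠ s := fun h => hno s hs (h ▸ List.take_prefix _ _)
      obtain ⟨t, ht, hpt⟩ := hP.proper (w.take k) ⟨s, hs, hks, hne⟩ w[k]
      rw [List.take_concat_get' w k (by omega)] at hpt
      exact ⟨t, ht, hpt⟩
  obtain ⟨s, hs, hws⟩ := key w.length le_rfl
  rw [List.take_length] at hws
  have hlen : w.length = s.length := le_antisymm hws.length_le ((hD s hs).trans hw)
  exact hno s hs (hws.eq_of_length hlen ▸ List.prefix_rfl)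

theorem exists_leaf_matches (hT : T ∈ models m D) (z : Fin D → Fin m) :
    ∃ s ∈ T, Matches s z :=
  exists_leaf_prefix hT (by simp)

theorem leaf_unique (hT : T ∈ models m D) {z : Fin D → Fin m} {s t : List (Fin m)} (hs : s ∈ T)
    (ht : t ∈ T) (hsz : Matches s z) (htz : Matches t z) : s = t :=
  (mem_models.1 hT).1.eq_of_prefix hs ht hsz htz

/-- Every context of length at most `D` is a suffix of some string of length `D`. -/
theorem exists_matches [NeZero m] {s : List (Fin m)} (hs : s.length ≤ D) :
    ∃ z : Fin D → Fin m, Matches s z := by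
  set l : List (Fin m) := (s ++ List.replicate (D - s.length) 0).reverse with hl
  have hlen : l.length = D := by
    simp [hl]
    omega
  refine ⟨fun i => l.get (i.cast hlen.symm), ?_⟩
  have h1 : List.ofFn (fun i : Fin D => l.get (i.cast hlen.symm)) = l :=
    (List.ofFn_congr hlen l.get).symm.trans (List.ofFn_get l)
  rw [Matches, h1, hl, List.reverse_reverse]
  exact List.prefix_append _ _

theorem condProb_eq_of_matches (hT : T ∈ models m D) (θ : T → Fin m → ℝ) {z : Fin D → Fin m}
    {s : List (Fin m)} (hs : s ∈ T) (hsz : Matches s z) (j : Fin m) :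
    condProb T θ z j = θ ⟨s, hs⟩ j := by
  unfold condProb
  rw [Finset.sum_eq_single (⟨s, hs⟩ : T), if_pos hsz]
  · intro t _ hne
    rw [if_neg]
    exact fun h => hne (Subtype.ext (leaf_unique hT t.2 hs h hsz))
  · simp

theorem condProb_nonneg {θ : T → Fin m → ℝ} (hθ : IsParam T θ) (z : Fin D → Fin m) (j : Fin m) :
    0 ≤ condProb T θ z j :=
  Finset.sum_nonneg fun s _ => by
    split_ifs
    exacts [(hθ s).1 j, le_rfl]

theorem sum_condProb (hT : T ∈ models m D) {θ : T → Fin m → ℝ} (hθ : IsParam T θ)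
    (z : Fin D → Fin m) : ∑ j, condProb T θ z j = 1 := by
  obtain ⟨s, hs, hsz⟩ := exists_leaf_matches hT z
  simp_rw [condProb_eq_of_matches hT θ hs hsz]
  exact (hθ _).2

end Trees

/-! ### Counts of states and transitions -/

section Counts

variable {m D : ℕ}

/-- The number of times that symbol `j` follows the string `z` of length `D` among the first `n`
observations. -/
def stateCount (x : ℕ → Fin m) (n : ℕ) (z : Fin D → Fin m) (j : Fin m) : ℕ :=
  ((Finset.range n).filter fun i => window D x i = z ∧ x (D + i) = j).card

/-- The number of times that the string `z` of length `D` precedes one of the first `n`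
observations. -/
def visits (x : ℕ → Fin m) (n : ℕ) (z : Fin D → Fin m) : ℕ :=
  ((Finset.range n).filter fun i => window D x i = z).card

theorem sum_stateCount (x : ℕ → Fin m) (n : ℕ) (z : Fin D → Fin m) :
    ∑ j, stateCount x n z j = visits x n z := by
  unfold stateCount visits
  rw [Finset.card_eq_sum_card_fiberwise (f := fun i => x (D + i)) (t := Finset.univ)
    (fun _ _ => Finset.mem_coe.2 (Finset.mem_univ _))]
  simp only [Finset.filter_filter]

theorem count_eq_sum_stateCount (x : ℕ → Fin m) (n : ℕ) (s : List (Fin m)) (j : Fin m) :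
    count D x n s j = ∑ z : Fin D → Fin m with Matches s z, stateCount x n z j := by
  unfold stateCount count
  rw [Finset.card_eq_sum_card_fiberwise (f := fun i => window D x i)
    (t := Finset.univ.filter fun z => Matches s z)
    (fun i hi => by
      have := (Finset.mem_filter.1 (Finset.mem_coe.1 hi)).2.1
      simpa using this)]
  refine Finset.sum_congr rfl fun z hz => ?_
  have hz' : Matches s z := (Finset.mem_filter.1 hz).2
  congr 1
  ext i
  simp only [Finset.mem_filter]
  constructor
  · rintro ⟨⟨h1, h2, h3⟩, h4⟩
    exact ⟨h1, h4, h3⟩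
  · rintro ⟨h1, h2, h3⟩
    exact ⟨⟨h1, h2 ▸ hz', h3⟩, h2⟩

theorem visits_le (x : ℕ → Fin m) (n : ℕ) (z : Fin D → Fin m) : visits x n z ≤ n :=
  (Finset.card_filter_le _ _).trans (by simp)

theorem window_congr_of_lt {n : ℕ} {x y : ℕ → Fin m} (h : ∀ k < D + n, x k = y k) {i : ℕ}
    (hi : i < n) : window D x i = window D y i :=
  window_congr fun k hk => h k (by omega)

theorem stateCount_congr {n : ℕ} {x y : ℕ → Fin m} (h : ∀ k < D + n, x k = y k)
    (z : Fin D → Fin m) (j : Fin m) : stateCount x n z j = stateCount y n z j := by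
  unfold stateCount
  congr 1
  refine Finset.filter_congr fun i hi => ?_
  have hi' := Finset.mem_range.1 hi
  rw [window_congr_of_lt h hi', h (D + i) (by omega)]

theorem visits_congr {n : ℕ} {x y : ℕ → Fin m} (h : ∀ k < D + n, x k = y k)
    (z : Fin D → Fin m) : visits x n z = visits y n z := by
  simp_rw [← sum_stateCount, stateCount_congr h]

theorem update_apply_of_lt (x : ℕ → Fin m) (N : ℕ) (j : Fin m) :
    ∀ k < N, Function.update x N j k = x k :=
  fun _ hk => Function.update_of_ne hk.ne _ _

theorem stateCount_succ_update (x : ℕ → Fin m) (n : ℕ) (z : Fin D → Fin m) (i j : Fin m) :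
    stateCount (Function.update x (D + n) i) (n + 1) z j =
      stateCount x n z j + if window D x n = z ∧ i = j then 1 else 0 := by
  rw [← stateCount_congr (update_apply_of_lt x (D + n) i) z j]
  unfold stateCount
  rw [Finset.range_add_one, Finset.filter_insert, window_congr (update_apply_of_lt x (D + n) i),
    Function.update_self]
  split_ifs with h
  · rw [Finset.card_insert_of_notMem (by simp)]
  · rfl

theorem visits_succ_update (x : ℕ → Fin m) (n : ℕ) (z : Fin D → Fin m) (i : Fin m) :
    visits (Function.update x (D + n) i) (n + 1) z =
      visits x n z + if window D x n = z then 1 else 0 := by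
  rw [← visits_congr (update_apply_of_lt x (D + n) i) z]
  unfold visits
  rw [Finset.range_add_one, Finset.filter_insert, window_congr (update_apply_of_lt x (D + n) i)]
  split_ifs with h
  · rw [Finset.card_insert_of_notMem (by simp)]
  · rfl

theorem window_succ_update (x : ℕ → Fin m) (n : ℕ) (j : Fin m) :
    window D (Function.update x (D + n) j) (n + 1) = shift (window D x n) j := by
  funext k
  simp only [window, shift, Fin.tail, Fin.snoc]
  split_ifs with h
  · have h' : (k : ℕ) + 1 < D := by simpa using h
    rw [Function.update_of_ne (by omega)]
    simp [add_assoc, add_comm 1]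
  · have h' : ¬ (k : ℕ) + 1 < D := by simpa using h
    have : n + 1 + (k : ℕ) = D + n := by omega
    rw [this, Function.update_self]
    rfl

end Counts

/-! ### Positive frequency of every state -/

/-- For an irreducible stochastic matrix, a positive function that decreases exponentially along
the chain except at visits to the state `z`. With `u = ∑_{k ≤ K} 2⁻ᵏ Pᵏ(·, z)` one has
`P u ≥ 2 u` away from `z`, and `h = 1 - u / 4` is as required. -/
theorem exists_exponential_lyapunov {ι : Type*} [Fintype ι] [DecidableEq ι] {P : Matrix ι ι ℝ}
    (h0 : ∀ i j, 0 ≤ P i j) (h1 : ∀ i, ∑ j, P i j = 1) (hirr : P.IsIrreducible) (z : ι) :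
    ∃ κ : ℝ, 0 < κ ∧ ∃ l : ℝ, 0 < l ∧ ∃ h : ι → ℝ, (∀ w, 1 / 2 ≤ h w) ∧
      ∀ w, Real.exp (κ - if w = z then l else 0) * ∑ w', P w w' * h w' ≤ h w := by
  have hpow : ∀ k i, (∀ j, 0 ≤ (P ^ k) i j) ∧ ∑ j, (P ^ k) i j = 1 := by
    intro k
    induction k with
    | zero =>
      intro i
      refine ⟨fun j => ?_, ?_⟩
      · rw [pow_zero, Matrix.one_apply]
        split_ifs <;> norm_num
      · simp [Matrix.one_apply]
    | succ k ih =>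
      intro i
      rw [pow_succ']
      simp_rw [Matrix.mul_apply]
      refine ⟨fun j => Finset.sum_nonneg fun l _ => mul_nonneg (h0 _ _) ((ih l).1 j), ?_⟩
      rw [Finset.sum_comm]
      simp_rw [← Finset.mul_sum, (ih _).2, mul_one]
      exact h1 i
  have hle : ∀ k i j, (P ^ k) i j ≤ 1 := fun k i j => by
    rw [← (hpow k i).2]
    exact Finset.single_le_sum (fun l _ => (hpow k i).1 l) (Finset.mem_univ j)
  have hreach := (Matrix.isIrreducible_iff_exists_pow_pos h0).1 hirr
  choose k _ hk using fun w => hreach w z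
  set K := Finset.univ.sup k with hK
  set u : ι → ℝ := fun w => ∑ i ∈ Finset.range (K + 1), (1 / 2 : ℝ) ^ i * (P ^ i) w z with hu
  have hterm : ∀ w i, 0 ≤ (1 / 2 : ℝ) ^ i * (P ^ i) w z := fun w i =>
    mul_nonneg (by positivity) ((hpow i w).1 z)
  have hu0 : ∀ w, 0 < u w := fun w => by
    refine lt_of_lt_of_le (mul_pos (by positivity : (0 : ℝ) < (1 / 2) ^ k w) (hk w))
      (Finset.single_le_sum (f := fun i => (1 / 2 : ℝ) ^ i * (P ^ i) w z)
        (fun i _ => hterm w i) ?_)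
    exact Finset.mem_range.2 (Nat.lt_succ_of_le (Finset.le_sup (Finset.mem_univ w)))
  have hu2 : ∀ w, u w ≤ 2 := fun w => by
    refine le_trans (Finset.sum_le_sum (g := fun i => (1 / 2 : ℝ) ^ i) fun i _ => ?_)
      (sum_geometric_two_le _)
    exact mul_le_of_le_one_right (by positivity) (hle _ _ _)
  have hPu : ∀ w, 2 * (u w - if w = z then 1 else 0) ≤ ∑ w', P w w' * u w' := by
    intro w
    have h2 : ∑ w', P w w' * u w' =
        2 * ∑ i ∈ Finset.range (K + 1), (1 / 2 : ℝ) ^ (i + 1) * (P ^ (i + 1)) w z := by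
      simp_rw [hu, Finset.mul_sum]
      rw [Finset.sum_comm]
      refine Finset.sum_congr rfl fun i _ => ?_
      rw [pow_succ' P, Matrix.mul_apply, Finset.mul_sum, Finset.mul_sum]
      refine Finset.sum_congr rfl fun w' _ => ?_
      rw [pow_succ (1 / 2 : ℝ)]
      ring
    have h3 := Finset.sum_range_succ' (fun i => (1 / 2 : ℝ) ^ i * (P ^ i) w z) (K + 1)
    have h4 := Finset.sum_range_succ (fun i => (1 / 2 : ℝ) ^ i * (P ^ i) w z) (K + 1)
    have h5 : (1 / 2 : ℝ) ^ 0 * (P ^ 0) w z = if w = z then 1 else 0 := by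
      simp [Matrix.one_apply]
    have h6 := hterm w (K + 1)
    rw [h2]
    simp only [hu]
    linarith
  have hne : (Finset.univ : Finset ι).Nonempty := ⟨z, Finset.mem_univ z⟩
  obtain ⟨w₀, -, hw₀⟩ := Finset.exists_min_image Finset.univ u hne
  -- `P h ≤ 1 - u / 2 ≤ (1 - κ) h` away from `z`, and at `z` the factor `exp (κ - l) = 1 / 2`
  -- brings `P h ≤ 1` below `h`.
  set κ := u w₀ / 4 with hκ
  have hκ0 : 0 < κ := div_pos (hu0 _) (by norm_num)
  refine ⟨κ, hκ0, κ + Real.log 2, by linarith [Real.log_pos one_lt_two], fun w => 1 - u w / 4,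
    fun w => by linarith [hu2 w], fun w => ?_⟩
  have hPh : ∑ w', P w w' * (1 - u w' / 4) = 1 - (∑ w', P w w' * u w') / 4 := by
    simp_rw [mul_sub, mul_one, Finset.sum_sub_distrib, h1, Finset.sum_div, mul_div_assoc]
  rw [hPh]
  have h7 := hPu w
  have h8 := hw₀ w (Finset.mem_univ w)
  have h9 := hu2 w
  have h10 := hu0 w
  split_ifs at h7 ⊢ with hwz
  · rw [show κ - (κ + Real.log 2) = -Real.log 2 by ring, Real.exp_neg, Real.exp_log two_pos]
    have h11 : 0 ≤ ∑ w', P w w' * u w' :=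
      Finset.sum_nonneg fun w' _ => mul_nonneg (h0 _ _) (hu0 _).le
    linarith
  · rw [sub_zero]
    have h11 : 1 - (∑ w', P w w' * u w') / 4 ≤ (1 - κ) * (1 - u w / 4) := by nlinarith
    have h12 : 1 - κ ≤ Real.exp (-κ) := by linarith [Real.add_one_le_exp (-κ)]
    calc _ ≤ Real.exp κ * ((1 - κ) * (1 - u w / 4)) :=
          mul_le_mul_of_nonneg_left h11 (Real.exp_pos _).le
      _ ≤ Real.exp κ * (Real.exp (-κ) * (1 - u w / 4)) := by
          refine mul_le_mul_of_nonneg_left (mul_le_mul_of_nonneg_right h12 ?_) (Real.exp_pos _).le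
          linarith
      _ = 1 - u w / 4 := by
          rw [← mul_assoc, ← Real.exp_add]
          simp

theorem sum_transition_mul {m D : ℕ} (T : Finset (List (Fin m))) (θ : T → Fin m → ℝ)
    (z : Fin D → Fin m) (h : (Fin D → Fin m) → ℝ) :
    ∑ w, transition D T θ z w * h w = ∑ j, condProb T θ z j * h (shift z j) := by
  simp_rw [transition, Finset.sum_mul]
  rw [Finset.sum_comm]
  refine Finset.sum_congr rfl fun j _ => ?_
  simp_rw [ite_mul, zero_mul]
  rw [Finset.sum_ite_eq]
  simp

section Chain

variable {Ω : Type*} [MeasurableSpace Ω] {μ : Measure Ω} [IsProbabilityMeasure μ] {m D : ℕ}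
  {T : Finset (List (Fin m))} {θ : T → Fin m → ℝ} {X : ℕ → Ω → Fin m}

/-- Almost surely every string of length `D` occurs with positive lower frequency: with the Lyapunov
function `h`, the functional `exp (κ n - l * visits) * h` is a supermartingale. -/
theorem ae_visits_linear [NeZero m] (hT : T ∈ models m D) (hθ : IsParam T θ)
    (herg : IsErgodic D T θ) (hX : IsVariableMemoryChain μ D T θ X) :
    ∀ᵐ ω ∂μ, ∀ z : Fin D → Fin m, ∃ c : ℝ, 0 < c ∧
      ∀ᶠ n : ℕ in atTop, c * n ≤ visits (fun k => X k ω) n z := by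
  rw [ae_all_iff]
  intro z
  have h0 : ∀ z w, 0 ≤ transition D T θ z w := fun z w => Finset.sum_nonneg fun j _ => by
    split_ifs
    exacts [condProb_nonneg hθ _ _, le_rfl]
  have h1 : ∀ z, ∑ w, transition D T θ z w = 1 := fun z => by
    have := sum_transition_mul T θ z fun _ => 1
    simp only [mul_one, sum_condProb hT hθ] at this
    exact this
  obtain ⟨κ, hκ, l, hl, h, hh, hstep⟩ := exists_exponential_lyapunov h0 h1 herg.1 z
  have hbdd := ae_bounded_of_superharmonic hX (condProb_nonneg hθ)
    (F := fun n x => Real.exp (κ * n - l * visits x n z) * h (window D x n))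
    (fun n x => mul_nonneg (Real.exp_pos _).le (le_trans (by norm_num) (hh _)))
    (fun n x y hxy => by simp only [visits_congr hxy, window_congr hxy])
    (fun n x => by
      have hs := hstep (window D x n)
      rw [sum_transition_mul] at hs
      simp only [visits_succ_update, window_succ_update]
      refine le_of_eq_of_le ?_ (mul_le_mul_of_nonneg_left hs
        (Real.exp_pos (κ * n - l * visits x n z)).le)
      rw [← mul_assoc, ← Real.exp_add, Finset.mul_sum]
      refine Finset.sum_congr rfl fun j _ => ?_
      rw [mul_left_comm]
      congr 2
      push_cast
      split_ifs <;> ring)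
  filter_upwards [hbdd] with ω ⟨C, hC⟩
  refine ⟨κ / (2 * l), by positivity, ?_⟩
  have hlim : Tendsto (fun n : ℕ => κ / 2 * (n : ℝ)) atTop atTop :=
    tendsto_natCast_atTop_atTop.const_mul_atTop (by positivity)
  filter_upwards [hlim.eventually_ge_atTop (2 * C)] with n hn
  have h2 := hC n
  set V : ℝ := (visits (fun k => X k ω) n z : ℝ)
  have h3 := Real.add_one_le_exp (κ * n - l * V)
  have h4 : (κ * n - l * V) * (1 / 2) ≤ C := by
    refine le_trans ?_ h2
    refine le_trans ?_ (mul_le_mul_of_nonneg_left (hh _) (Real.exp_pos _).le)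
    exact mul_le_mul_of_nonneg_right (by linarith) (by norm_num)
  have h5 : κ / 2 * n ≤ l * V := by linarith
  rw [div_mul_eq_mul_div, div_le_iff₀ (by positivity)]
  linarith

end Chain

/-! ### Fluctuations of the transition counts -/

/-- If every `exp (λ S - λ² V)`, `λ = ±2⁻ⁱ`, is at most `C (i + 1)²` and `V n ≤ n`, then `S` is
of the order of the law of the iterated logarithm up to a power of `log log n`; in particular
`S n ^ 2 = o(n log n)`. The optimal choice of `λ` is about `n ^ (-1/2)`. -/
theorem eventually_sq_le_of_exp_bound {S V : ℕ → ℝ} (hV : ∀ n, V n ≤ n) {C : ℝ}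
    (h : ∀ n i : ℕ, Real.exp ((1 / 2) ^ i * |S n| - ((1 / 2) ^ i) ^ 2 * V n) ≤
      C * ((i : ℝ) + 1) ^ 2) {ε : ℝ} (hε : 0 < ε) :
    ∀ᶠ n : ℕ in atTop, S n ^ 2 ≤ ε * (n * Real.log n) := by
  have hC : 0 < C := by
    have := (Real.exp_pos _).trans_le (h 0 0)
    simpa using this
  set c : ℝ := 4 + |Real.log C| with hc
  have hc0 : 0 ≤ c := by positivity
  have hev : ∀ᶠ i : ℕ in atTop, (c + 2 * Real.log ((i : ℝ) + 1)) ^ 2 ≤ ε * i := by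
    have h1 : Tendsto (fun i : ℕ => (i : ℝ) + 1) atTop atTop :=
      tendsto_atTop_add_const_right _ _ tendsto_natCast_atTop_atTop
    have h2 := h1.eventually ((Real.isLittleO_pow_log_id_atTop (n := 2)).def
      (by positivity : 0 < ε / 32))
    have h3 : Tendsto (fun i : ℕ => ε / 4 * (i : ℝ)) atTop atTop :=
      tendsto_natCast_atTop_atTop.const_mul_atTop (by positivity)
    filter_upwards [h2, h3.eventually_ge_atTop (2 * c ^ 2), eventually_ge_atTop 1] with i hi hi' h1i
    have h4 : (1 : ℝ) ≤ i := by exact_mod_cast h1i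
    rw [Real.norm_of_nonneg (by positivity), id, Real.norm_of_nonneg (by positivity)] at hi
    nlinarith [sq_nonneg (c - 2 * Real.log ((i : ℝ) + 1))]
  have hlog : Tendsto (Nat.log 4) atTop atTop := tendsto_atTop.2 fun b => by
    filter_upwards [eventually_ge_atTop (4 ^ b)] with n hn
    exact Nat.le_log_of_pow_le (by norm_num) hn
  filter_upwards [hlog.eventually hev, eventually_ge_atTop 1] with n hn hn1
  -- With `i = log₄ n`, the value `λ = 2⁻ⁱ` is within a factor `2` of `n ^ (-1/2)`.
  set i := Nat.log 4 n with hi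
  have hlo : 4 ^ i ≤ n := Nat.pow_log_le_self 4 (by omega)
  have hhi : n < 4 ^ (i + 1) := Nat.lt_pow_succ_log_self (by norm_num) n
  set t : ℝ := 2 ^ i with ht
  have ht0 : 0 < t := by positivity
  have ht2 : t ^ 2 = 4 ^ i := by rw [ht, ← pow_mul, mul_comm, pow_mul]; norm_num
  have hlo' : t ^ 2 ≤ n := by rw [ht2]; exact_mod_cast hlo
  have hhi' : (n : ℝ) ≤ 4 * t ^ 2 := by
    rw [ht2, ← pow_succ']
    exact_mod_cast hhi.le
  have h1 := Real.log_le_log (Real.exp_pos _) (h n i)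
  rw [Real.log_exp, Real.log_mul hC.ne' (by positivity), Real.log_pow, one_div_pow, ← ht] at h1
  have h2 : 1 / t * |S n| ≤ c + 2 * Real.log ((i : ℝ) + 1) := by
    have h3 : (1 / t) ^ 2 * V n ≤ 4 := by
      rw [one_div_pow, div_mul_eq_mul_div, one_mul, div_le_iff₀ (by positivity)]
      exact (hV n).trans hhi'
    have := le_abs_self (Real.log C)
    push_cast at h1
    linarith
  have h4 : |S n| ≤ t * (c + 2 * Real.log ((i : ℝ) + 1)) := by
    rwa [one_div, inv_mul_le_iff₀ ht0] at h2
  have h5 : (i : ℝ) ≤ Real.log n := by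
    have h6 := Real.log_le_log (by positivity) hlo'
    have h7 : 1 ≤ 2 * Real.log 2 := by linarith [Real.log_two_gt_d9]
    rw [ht, ← pow_mul, Real.log_pow] at h6
    push_cast at h6
    nlinarith [(Nat.cast_nonneg i : (0 : ℝ) ≤ i)]
  calc S n ^ 2 = |S n| ^ 2 := (sq_abs _).symm
    _ ≤ (t * (c + 2 * Real.log ((i : ℝ) + 1))) ^ 2 := pow_le_pow_left₀ (abs_nonneg _) h4 2
    _ = t ^ 2 * (c + 2 * Real.log ((i : ℝ) + 1)) ^ 2 := mul_pow _ _ _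
    _ ≤ n * (ε * i) := mul_le_mul hlo' hn (sq_nonneg _) (by positivity)
    _ ≤ n * (ε * Real.log n) := by gcongr
    _ = ε * (n * Real.log n) := by ring

/-- A bound for the moment generating function of a centred indicator. -/
theorem sum_mul_exp_centred_le {ι : Type*} [Fintype ι] [DecidableEq ι] {p : ι → ℝ}
    (hp : ∀ i, 0 ≤ p i) (hp1 : ∑ i, p i = 1) (j : ι) {l : ℝ} (hl : |l| ≤ 1) :
    ∑ i, p i * Real.exp (l * ((if i = j then 1 else 0) - p j)) ≤ Real.exp (l ^ 2) := by
  have hpj : p j ≤ 1 := hp1 ▸ Finset.single_le_sum (fun i _ => hp i) (Finset.mem_univ j)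
  have hd : ∀ i, |(if i = j then (1 : ℝ) else 0) - p j| ≤ 1 := fun i => by
    have := hp j
    rw [abs_le]
    split_ifs <;> constructor <;> linarith
  have key : ∀ i, p i * Real.exp (l * ((if i = j then 1 else 0) - p j)) ≤
      p i + l * (p i * (if i = j then 1 else 0) - p i * p j) + p i * l ^ 2 := by
    intro i
    set y := (if i = j then (1 : ℝ) else 0) - p j with hy
    have h1 : |l * y| ≤ 1 := by
      rw [abs_mul]
      exact mul_le_one₀ hl (abs_nonneg _) (hd i)
    have h2 := (abs_le.1 (Real.abs_exp_sub_one_sub_id_le h1)).2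
    have h3 : (l * y) ^ 2 ≤ l ^ 2 := by
      rw [mul_pow]
      exact mul_le_of_le_one_right (sq_nonneg _) ((sq_le_one_iff_abs_le_one _).2 (hd i))
    have h4 : Real.exp (l * y) ≤ 1 + l * y + l ^ 2 := by linarith
    refine (mul_le_mul_of_nonneg_left h4 (hp i)).trans (le_of_eq ?_)
    rw [hy]
    ring
  refine (Finset.sum_le_sum fun i _ => key i).trans ?_
  rw [Finset.sum_add_distrib, Finset.sum_add_distrib, ← Finset.mul_sum, Finset.sum_sub_distrib,
    ← Finset.sum_mul, ← Finset.sum_mul, hp1]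
  simp only [mul_ite, mul_one, mul_zero, Finset.sum_ite_eq', Finset.mem_univ, if_true]
  linarith [Real.add_one_le_exp (l ^ 2)]

section Chain

variable {Ω : Type*} [MeasurableSpace Ω] {μ : Measure Ω} {m D : ℕ}
  {T : Finset (List (Fin m))} {θ : T → Fin m → ℝ} {X : ℕ → Ω → Fin m}

/-- The centred count of the transitions from the string `z` to the symbol `j`. -/
noncomputable def centredCount (T : Finset (List (Fin m))) (θ : T → Fin m → ℝ)
    (x : ℕ → Fin m) (n : ℕ) (z : Fin D → Fin m) (j : Fin m) : ℝ :=
  stateCount x n z j - visits x n z * condProb T θ z j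

/-- The exponential functionals of the centred count do not increase on average. -/
theorem exp_centredCount_superharmonic (hT : T ∈ models m D) (hθ : IsParam T θ)
    (z : Fin D → Fin m) (j : Fin m) {l : ℝ} (hl : |l| ≤ 1) (n : ℕ) (x : ℕ → Fin m) :
    ∑ i, condProb T θ (window D x n) i *
      Real.exp (l * centredCount T θ (Function.update x (D + n) i) (n + 1) z j -
        l ^ 2 * visits (Function.update x (D + n) i) (n + 1) z) ≤
      Real.exp (l * centredCount T θ x n z j - l ^ 2 * visits x n z) := by
  simp only [centredCount, stateCount_succ_update, visits_succ_update]
  by_cases hz : window D x n = z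
  · have h := sum_mul_exp_centred_le (condProb_nonneg hθ z) (sum_condProb hT hθ z) j hl
    set E := Real.exp (l * centredCount T θ x n z j - l ^ 2 * visits x n z) with hE
    have h1 : ∀ i, Real.exp (l * (((stateCount x n z j + if window D x n = z ∧ i = j then 1 else 0 :
        ℕ) : ℝ) - ((visits x n z + if window D x n = z then 1 else 0 : ℕ) : ℝ) * condProb T θ z j) -
        l ^ 2 * ((visits x n z + if window D x n = z then 1 else 0 : ℕ) : ℝ)) =
        E * Real.exp (-l ^ 2) *
          Real.exp (l * ((if i = j then 1 else 0) - condProb T θ z j)) := by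
      intro i
      rw [hE, ← Real.exp_add, ← Real.exp_add, centredCount]
      simp only [hz, true_and, if_true]
      congr 1
      push_cast
      ring
    simp_rw [h1]
    rw [hz]
    calc _ = E * Real.exp (-l ^ 2) * ∑ i, condProb T θ z i *
          Real.exp (l * ((if i = j then 1 else 0) - condProb T θ z j)) := by
          rw [Finset.mul_sum]
          exact Finset.sum_congr rfl fun i _ => by ring
      _ ≤ E * Real.exp (-l ^ 2) * Real.exp (l ^ 2) := by gcongr
      _ = E := by rw [mul_assoc, ← Real.exp_add]; simp
  · simp only [hz, false_and, if_false, add_zero]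
    rw [← Finset.sum_mul, sum_condProb hT hθ, one_mul]

theorem summable_mixture (S : ℝ) {V : ℝ} (hV : 0 ≤ V) {l : ℕ → ℝ} (hl : ∀ i, |l i| ≤ 1) :
    Summable fun i : ℕ => 1 / ((i : ℝ) + 1) ^ 2 * Real.exp (l i * S - l i ^ 2 * V) := by
  have h1 : Summable fun i : ℕ => 1 / ((i : ℝ) + 1) ^ 2 := by
    have := (summable_nat_add_iff 1).2 (Real.summable_one_div_nat_pow.2 one_lt_two)
    simpa using this
  refine Summable.of_nonneg_of_le (fun i => by positivity) (fun i => ?_)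
    (h1.mul_right (Real.exp |S|))
  refine mul_le_mul_of_nonneg_left (Real.exp_le_exp.2 ?_) (by positivity)
  have h2 : l i * S ≤ |S| := (le_abs_self _).trans (by
    rw [abs_mul]
    exact mul_le_of_le_one_left (abs_nonneg _) (hl i))
  linarith [mul_nonneg (sq_nonneg (l i)) hV]

/-- Mixing the exponential supermartingales over a sequence of values of `l` with weights
`(i + 1)⁻²` bounds all of them at once. -/
theorem ae_exp_centredCount_le [IsProbabilityMeasure μ] [NeZero m] (hT : T ∈ models m D)
    (hθ : IsParam T θ) (hX : IsVariableMemoryChain μ D T θ X) (z : Fin D → Fin m) (j : Fin m) {l : ℕ → ℝ}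
    (hl : ∀ i, |l i| ≤ 1) :
    ∀ᵐ ω ∂μ, ∃ C : ℝ, ∀ n i : ℕ,
      Real.exp (l i * centredCount T θ (fun k => X k ω) n z j -
        l i ^ 2 * visits (fun k => X k ω) n z) ≤ C * ((i : ℝ) + 1) ^ 2 := by
  have hsum : ∀ n x, Summable fun i : ℕ => 1 / ((i : ℝ) + 1) ^ 2 *
      Real.exp (l i * centredCount T θ x n z j - l i ^ 2 * visits x n z) := fun n x =>
    summable_mixture _ (Nat.cast_nonneg _) hl
  have hbdd := ae_bounded_of_superharmonic hX (condProb_nonneg hθ)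
    (F := fun n x => ∑' i : ℕ, 1 / ((i : ℝ) + 1) ^ 2 *
      Real.exp (l i * centredCount T θ x n z j - l i ^ 2 * visits x n z))
    (fun n x => tsum_nonneg fun i => by positivity)
    (fun n x y hxy => by simp only [centredCount, visits_congr hxy, stateCount_congr hxy])
    (fun n x => by
      simp_rw [← tsum_mul_left]
      rw [← Summable.tsum_finsetSum fun i _ => (hsum _ _).mul_left _]
      refine Summable.tsum_le_tsum (fun i => ?_)
        (summable_sum fun i _ => (hsum _ _).mul_left _) (hsum n x)
      simp_rw [mul_left_comm _ (1 / ((i : ℝ) + 1) ^ 2), ← Finset.mul_sum]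
      exact mul_le_mul_of_nonneg_left (exp_centredCount_superharmonic hT hθ z j (hl i) n x)
        (by positivity))
  filter_upwards [hbdd] with ω ⟨C, hC⟩
  refine ⟨C, fun n i => ?_⟩
  have h1 := ((hsum n fun k => X k ω).le_tsum i fun k _ => by positivity).trans (hC n)
  rwa [one_div, inv_mul_le_iff₀ (by positivity), mul_comm _ C] at h1

/-- A weak form of the law of the iterated logarithm for the transition counts. -/
theorem ae_centredCount_sq_le [IsProbabilityMeasure μ] [NeZero m] (hT : T ∈ models m D)
    (hθ : IsParam T θ) (hX : IsVariableMemoryChain μ D T θ X) :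
    ∀ᵐ ω ∂μ, ∀ (z : Fin D → Fin m) (j : Fin m) (ε : ℝ), 0 < ε → ∀ᶠ n : ℕ in atTop,
      centredCount T θ (fun k => X k ω) n z j ^ 2 ≤ ε * (n * Real.log n) := by
  simp_rw [ae_all_iff (ι := Fin D → Fin m), ae_all_iff (ι := Fin m)]
  intro z j
  have hl : ∀ i : ℕ, |(1 / 2 : ℝ) ^ i| ≤ 1 := fun i => by
    rw [abs_of_nonneg (by positivity)]
    exact pow_le_one₀ (by norm_num) (by norm_num)
  filter_upwards [ae_exp_centredCount_le hT hθ hX z j hl,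
    ae_exp_centredCount_le hT hθ hX z j (l := fun i => -(1 / 2 : ℝ) ^ i)
      (fun i => by rw [abs_neg]; exact hl i)] with ω ⟨C₁, h₁⟩ ⟨C₂, h₂⟩ ε hε
  refine eventually_sq_le_of_exp_bound (V := fun n => (visits (fun k => X k ω) n z : ℝ))
    (C := max C₁ C₂) (fun n => by exact_mod_cast visits_le _ _ _) (fun n i => ?_) hε
  rcases abs_choice (centredCount T θ (fun k => X k ω) n z j) with h | h
  · rw [h]
    exact (h₁ n i).trans (mul_le_mul_of_nonneg_right (le_max_left _ _) (by positivity))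
  · rw [h]
    have h3 := h₂ n i
    rw [neg_mul, neg_sq, ← mul_neg] at h3
    exact h3.trans (mul_le_mul_of_nonneg_right (le_max_right _ _) (by positivity))

/-- A symbol of conditional probability zero after `z` almost surely never follows `z`. -/
theorem ae_stateCount_eq_zero [NeZero m] (hX : IsVariableMemoryChain μ D T θ X) :
    ∀ᵐ ω ∂μ, ∀ (n : ℕ) (z : Fin D → Fin m) (j : Fin m), condProb T θ z j = 0 →
      stateCount (fun k => X k ω) n z j = 0 := by
  filter_upwards [ae_condProb_ne_zero hX] with ω hω n z j h
  refine Finset.card_eq_zero.2 (Finset.filter_eq_empty_iff.2 fun i _ hi => hω i ?_)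
  rw [hi.1, show X (D + i) ω = j from hi.2]
  exact h

end Chain

/-! ### Competing trees -/

section Trees

variable {m D : ℕ} {T T' : Finset (List (Fin m))}

/-- If the parameters of a minimal tree `T` do not vary below the leaf `u` of another tree, then
`u` extends a leaf of `T`: otherwise the longest leaves of `T` below `u` would be siblings sharing
their parameters. -/
theorem exists_leaf_prefix_of_condProb_eq [NeZero m] (hT : T ∈ models m D) {θ : T → Fin m → ℝ}
    (hmin : IsMinimal T θ) {u : List (Fin m)} (hu : u.length ≤ D)
    (hconst : ∀ z z' : Fin D → Fin m, Matches u z → Matches u z' →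
      condProb T θ z = condProb T θ z') : ∃ v ∈ T, v <+: u := by
  obtain ⟨hP, hD⟩ := mem_models.1 hT
  obtain ⟨z, hz⟩ := exists_matches hu
  obtain ⟨v, hv, hvz⟩ := exists_leaf_matches hT z
  rcases List.prefix_or_prefix_of_prefix hvz hz with h | h
  · exact ⟨v, hv, h⟩
  by_contra! hno
  have hne : (T.filter fun s => u <+: s).Nonempty := ⟨v, Finset.mem_filter.2 ⟨hv, h⟩⟩
  -- A longest leaf below `u`; its siblings are nodes, hence leaves.
  obtain ⟨w, hw, hmax⟩ := Finset.exists_max_image _ List.length hne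
  obtain ⟨hwT, huw⟩ := Finset.mem_filter.1 hw
  have huw' : u ≠ w := fun h => hno w hwT (h ▸ List.prefix_rfl)
  have hw0 : w ≠ [] := by
    rintro rfl
    exact huw' (List.prefix_nil.1 huw)
  obtain ⟨s, j, rfl⟩ : ∃ s j, w = s ++ [j] :=
    ⟨w.dropLast, w.getLast hw0, (List.dropLast_append_getLast hw0).symm⟩
  have hus : u <+: s := (List.prefix_concat_iff.1 huw).resolve_left huw'
  have hsib : ∀ i, s ++ [i] ∈ T := by
    intro i
    obtain ⟨t, ht, hst⟩ := hP.proper s ⟨s ++ [j], hwT, List.prefix_append _ _, by simp⟩ i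
    have hut : u <+: t := hus.trans ((List.prefix_append s [i]).trans hst)
    have hlen := hmax t (Finset.mem_filter.2 ⟨ht, hut⟩)
    have : s ++ [i] = t := hst.eq_of_length (le_antisymm hst.length_le (by simpa using hlen))
    rwa [this]
  rcases hmin with rfl | hmin
  · exact absurd (hsib j) (by simp)
  obtain ⟨i, i', hii⟩ := hmin s hsib
  obtain ⟨y, hy⟩ := exists_matches (hD _ (hsib i))
  obtain ⟨y', hy'⟩ := exists_matches (hD _ (hsib i'))
  have hpre : ∀ i, u <+: s ++ [i] := fun i => hus.trans (List.prefix_append _ _)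
  have h1 := hconst y y' ((hpre i).trans hy) ((hpre i').trans hy')
  refine hii (funext fun k => ?_)
  rw [← condProb_eq_of_matches hT θ (hsib i) hy, ← condProb_eq_of_matches hT θ (hsib i') hy', h1]

/-- A strict refinement of a tree has more leaves: sending a leaf of `T'` to the leaf of `T` that it
extends is onto, and it identifies the descendants of every leaf of `T` that is internal in `T'`. -/
theorem card_lt_of_refines (hm : 2 ≤ m) (hT : T ∈ models m D) (hT' : T' ∈ models m D)
    (hne : T' ≠ T) (href : ∀ u ∈ T', ∃ v ∈ T, v <+: u) : T.card < T'.card := by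
  have : NeZero m := ⟨by omega⟩
  classical
  obtain ⟨hP, hD⟩ := mem_models.1 hT
  obtain ⟨hP', -⟩ := mem_models.1 hT'
  choose! f hfT hfu using href
  have hsurj : T ⊆ T'.image f := by
    intro v hv
    obtain ⟨z, hz⟩ := exists_matches (hD v hv)
    obtain ⟨u, hu, huz⟩ := exists_leaf_matches hT' z
    exact Finset.mem_image.2
      ⟨u, hu, leaf_unique hT (hfT u hu) hv ((hfu u hu).trans huz) hz⟩
  have hle : T.card ≤ T'.card := (Finset.card_le_card hsurj).trans Finset.card_image_le
  refine lt_of_le_of_ne hle fun hcard => hne ?_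
  have hinj : Set.InjOn f T' := Finset.card_image_iff.1
    (le_antisymm Finset.card_image_le (hcard ▸ Finset.card_le_card hsurj))
  refine Finset.eq_of_subset_of_card_le (fun u hu => ?_) hcard.le
  suffices h : f u = u from h ▸ hfT u hu
  by_contra hfu'
  have hchild : ∀ j, ∃ t ∈ T', f u ++ [j] <+: t := hP'.proper (f u) ⟨u, hu, hfu u hu, hfu'⟩
  obtain ⟨t₀, ht₀, h₀⟩ := hchild ⟨0, by omega⟩
  obtain ⟨t₁, ht₁, h₁⟩ := hchild ⟨1, by omega⟩
  have hf : ∀ (t j), t ∈ T' → f u ++ [j] <+: t → f t = f u := fun t j ht h =>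
    hP.eq_of_prefix (hfT t ht) (hfT u hu) (hfu t ht) ((List.prefix_append _ _).trans h)
  have heq : t₀ = t₁ := hinj ht₀ ht₁ ((hf _ _ ht₀ h₀).trans (hf _ _ ht₁ h₁).symm)
  subst heq
  have h2 := (List.prefix_of_prefix_length_le h₀ h₁ (by simp)).eq_of_length (by simp)
  simp at h2

/-- A tree different from the minimal one either merges contexts with different conditional
distributions, or has more leaves. -/
theorem exists_merged_or_card_lt (hm : 2 ≤ m) (hT : T ∈ models m D) {θ : T → Fin m → ℝ}
    (hmin : IsMinimal T θ) (hT' : T' ∈ models m D) (hne : T' ≠ T) :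
    (∃ u ∈ T', ∃ z z' : Fin D → Fin m, Matches u z ∧ Matches u z' ∧
      ∃ j, condProb T θ z j ≠ condProb T θ z' j) ∨ T.card < T'.card := by
  have : NeZero m := ⟨by omega⟩
  by_contra! h
  obtain ⟨h1, h2⟩ := h
  refine absurd (card_lt_of_refines hm hT hT' hne fun u hu => ?_) (not_lt.2 h2)
  exact exists_leaf_prefix_of_condProb_eq hT hmin ((mem_models.1 hT').2 u hu)
    fun z z' hz hz' => funext fun j => h1 u hu z z' hz hz' j

/-- The sets of strings matched by the leaves of a tree partition the strings of length `D`. -/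
theorem sum_leaves_sum_matches (hT : T ∈ models m D) (f : (Fin D → Fin m) → ℝ) :
    ∑ s ∈ T, ∑ z : Fin D → Fin m with Matches s z, f z = ∑ z, f z := by
  simp_rw [Finset.sum_filter]
  rw [Finset.sum_comm]
  refine Finset.sum_congr rfl fun z _ => ?_
  obtain ⟨s, hs, hsz⟩ := exists_leaf_matches hT z
  rw [Finset.sum_eq_single_of_mem s hs, if_pos hsz]
  intro t ht hne
  exact if_neg fun h => hne (leaf_unique hT ht hs h hsz)

end Trees

/-! ### Maximal log-likelihoods of trees -/

section LogLik

variable {m D : ℕ} {T : Finset (List (Fin m))}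

/-- The log-likelihood of the first `n` observations at the parameters `θ`. -/
noncomputable def logLik (D : ℕ) (T : Finset (List (Fin m))) (θ : T → Fin m → ℝ) (x : ℕ → Fin m)
    (n : ℕ) : ℝ :=
  ∑ z : Fin D → Fin m, ∑ j, stateCount x n z j * Real.log (condProb T θ z j)

/-- The `χ²` statistic of the transition counts; transitions of probability zero, which do not
occur, contribute `0` through division by zero. -/
noncomputable def chiSq (D : ℕ) (T : Finset (List (Fin m))) (θ : T → Fin m → ℝ) (x : ℕ → Fin m)
    (n : ℕ) : ℝ :=
  ∑ z : Fin D → Fin m, ∑ j, centredCount T θ x n z j ^ 2 / (visits x n z * condProb T θ z j)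

/-- The empirical frequency of the symbol `j` after the context `s`. -/
noncomputable def empirical (D : ℕ) (x : ℕ → Fin m) (n : ℕ) (s : List (Fin m)) (j : Fin m) : ℝ :=
  count D x n s j / ∑ i, (count D x n s i : ℝ)

/-- A lower bound for the log-likelihood lost by merging the strings matched by each leaf of `T`:
the quadratic form of the differences between the empirical frequencies before and after
merging. -/
noncomputable def mergingLoss (D : ℕ) (T : Finset (List (Fin m))) (x : ℕ → Fin m) (n : ℕ) : ℝ :=
  ∑ s ∈ T, ∑ z : Fin D → Fin m with Matches s z, 1 / 4 * (visits x n z : ℝ) *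
    ∑ j, (stateCount x n z j / (visits x n z : ℝ) - empirical D x n s j) ^ 2

theorem sum_cast_stateCount (x : ℕ → Fin m) (n : ℕ) (z : Fin D → Fin m) :
    ∑ j, (stateCount x n z j : ℝ) = visits x n z := by
  exact_mod_cast sum_stateCount x n z

theorem sum_count_mul (x : ℕ → Fin m) (n : ℕ) (s : List (Fin m)) (g : Fin m → ℝ) :
    ∑ j, count D x n s j * g j =
      ∑ z : Fin D → Fin m with Matches s z, ∑ j, stateCount x n z j * g j := by
  rw [Finset.sum_comm]
  refine Finset.sum_congr rfl fun j _ => ?_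
  rw [count_eq_sum_stateCount, Nat.cast_sum, Finset.sum_mul]

theorem stateCount_le_count (x : ℕ → Fin m) (n : ℕ) {s : List (Fin m)} {z : Fin D → Fin m}
    (hz : Matches s z) (j : Fin m) : stateCount x n z j ≤ count D x n s j := by
  rw [count_eq_sum_stateCount]
  exact Finset.single_le_sum (f := fun z => stateCount x n z j) (fun _ _ => Nat.zero_le _)
    (Finset.mem_filter.2 ⟨Finset.mem_univ z, hz⟩)

theorem visits_le_sum_count (x : ℕ → Fin m) (n : ℕ) {s : List (Fin m)} {z : Fin D → Fin m}
    (hz : Matches s z) : visits x n z ≤ ∑ j, count D x n s j := by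
  rw [← sum_stateCount]
  exact Finset.sum_le_sum fun j _ => stateCount_le_count x n hz j

theorem sum_count_le (x : ℕ → Fin m) (n : ℕ) (s : List (Fin m)) :
    ∑ j, count D x n s j ≤ n := by
  have h : ∑ j, count D x n s j =
      ((Finset.range n).filter fun i => Matches s (window D x i)).card := by
    unfold count
    rw [Finset.card_eq_sum_card_fiberwise (f := fun i => x (D + i)) (t := Finset.univ)
      (fun _ _ => Finset.mem_coe.2 (Finset.mem_univ _))]
    simp only [Finset.filter_filter]
  rw [h]
  exact (Finset.card_filter_le _ _).trans (by simp)

/-- The true tree fits at least as well as the true parameters. -/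
theorem logLik_le_sum_maxLogLik (hT : T ∈ models m D) {θ : T → Fin m → ℝ} (hθ : IsParam T θ)
    {x : ℕ → Fin m} {n : ℕ} (h0 : ∀ (z : Fin D → Fin m) j, condProb T θ z j = 0 →
      stateCount x n z j = 0) :
    logLik D T θ x n ≤ ∑ s ∈ T, maxLogLik (count D x n s) := by
  rw [logLik, ← sum_leaves_sum_matches hT]
  refine Finset.sum_le_sum fun s hs => ?_
  have h1 : ∑ z : Fin D → Fin m with Matches s z,
      ∑ j, stateCount x n z j * Real.log (condProb T θ z j) =
      ∑ j, count D x n s j * Real.log (θ ⟨s, hs⟩ j) := by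
    rw [sum_count_mul]
    refine Finset.sum_congr rfl fun z hz => ?_
    simp_rw [condProb_eq_of_matches hT θ hs (Finset.mem_filter.1 hz).2]
  rw [h1]
  refine logLik_le_maxLogLik (hθ _).1 (hθ _).2 fun j hj => ?_
  rw [count_eq_sum_stateCount]
  refine Finset.sum_eq_zero fun z hz => h0 z j ?_
  rw [condProb_eq_of_matches hT θ hs (Finset.mem_filter.1 hz).2, hj]

/-- Even the finest tree gains no more than the `χ²` statistic over the true parameters. -/
theorem sum_maxLogLik_le_logLik_add (hT : T ∈ models m D) {θ : T → Fin m → ℝ} (hθ : IsParam T θ)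
    {x : ℕ → Fin m} {n : ℕ} (h0 : ∀ (z : Fin D → Fin m) j, condProb T θ z j = 0 →
      stateCount x n z j = 0) :
    ∑ z : Fin D → Fin m, maxLogLik (stateCount x n z) ≤ logLik D T θ x n + chiSq D T θ x n := by
  rw [logLik, chiSq, ← Finset.sum_add_distrib]
  refine Finset.sum_le_sum fun z _ => ?_
  have h := maxLogLik_le_logLik_add (condProb_nonneg hθ z) (sum_condProb hT hθ z) (h0 z)
  rwa [sum_cast_stateCount] at h

/-- Any tree fits worse than the finest one, by at least its merging loss. -/
theorem sum_maxLogLik_le_sub_mergingLoss [NeZero m] (hT : T ∈ models m D) {x : ℕ → Fin m} {n : ℕ}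
    (hv : ∀ z : Fin D → Fin m, 0 < visits x n z) :
    ∑ s ∈ T, maxLogLik (count D x n s) ≤
      ∑ z : Fin D → Fin m, maxLogLik (stateCount x n z) - mergingLoss D T x n := by
  rw [← sum_leaves_sum_matches hT, mergingLoss, ← Finset.sum_sub_distrib]
  refine Finset.sum_le_sum fun s hs => ?_
  obtain ⟨y, hy⟩ := exists_matches ((mem_models.1 hT).2 s hs)
  have hpos : (0 : ℝ) < ∑ i, (count D x n s i : ℝ) := by
    exact_mod_cast (hv y).trans_le (visits_le_sum_count x n hy)
  rw [maxLogLik, sum_count_mul, ← Finset.sum_sub_distrib]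
  refine Finset.sum_le_sum fun z hz => ?_
  have h := logLik_le_maxLogLik_sub (a := stateCount x n z) (q := empirical D x n s)
    (fun j => by unfold empirical; positivity)
    (by unfold empirical; rw [← Finset.sum_div, div_self hpos.ne']) (fun j hj => by
      have h1 : (count D x n s j : ℝ) = 0 := (div_eq_zero_iff.1 hj).resolve_right hpos.ne'
      have h2 := stateCount_le_count x n (Finset.mem_filter.1 hz).2 j
      have h3 : count D x n s j = 0 := by exact_mod_cast h1
      omega)
  rw [sum_cast_stateCount] at h
  exact h

theorem mergingLoss_nonneg (x : ℕ → Fin m) (n : ℕ) : 0 ≤ mergingLoss D T x n :=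
  Finset.sum_nonneg fun _ _ => Finset.sum_nonneg fun _ _ => by positivity

/-- Two strings matched by the same leaf cannot both have their empirical frequencies close to
those of the leaf when these differ. -/
theorem le_mergingLoss {x : ℕ → Fin m} {n : ℕ} {s : List (Fin m)} (hs : s ∈ T)
    {z z' : Fin D → Fin m} (hz : Matches s z) (hz' : Matches s z') {r : ℝ} (hr : r ≤ visits x n z)
    (hr' : r ≤ visits x n z') (hr0 : 0 ≤ r) (j : Fin m) :
    r / 8 * (stateCount x n z j / (visits x n z : ℝ) -
      stateCount x n z' j / (visits x n z' : ℝ)) ^ 2 ≤ mergingLoss D T x n := by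
  rcases eq_or_ne z z' with rfl | hne
  · simpa using mergingLoss_nonneg x n
  set g : (Fin D → Fin m) → ℝ := fun z => 1 / 4 * (visits x n z : ℝ) *
    ∑ j, (stateCount x n z j / (visits x n z : ℝ) - empirical D x n s j) ^ 2 with hg
  have hg0 : ∀ z, 0 ≤ g z := fun z => by positivity
  have h1 : g z + g z' ≤ mergingLoss D T x n := by
    have h2 : ∑ y : Fin D → Fin m with Matches s y, g y ≤ mergingLoss D T x n :=
      Finset.single_le_sum (f := fun s => ∑ z : Fin D → Fin m with Matches s z,
        1 / 4 * (visits x n z : ℝ) *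
        ∑ j, (stateCount x n z j / (visits x n z : ℝ) - empirical D x n s j) ^ 2)
        (fun _ _ => Finset.sum_nonneg fun _ _ => by positivity) hs
    refine le_trans ?_ h2
    rw [← Finset.sum_pair hne]
    refine Finset.sum_le_sum_of_subset_of_nonneg ?_ fun y _ _ => hg0 y
    intro y hy
    rcases Finset.mem_insert.1 hy with rfl | hy
    · exact Finset.mem_filter.2 ⟨Finset.mem_univ _, hz⟩
    · rw [Finset.mem_singleton.1 hy]
      exact Finset.mem_filter.2 ⟨Finset.mem_univ _, hz'⟩
  have h3 : ∀ y : Fin D → Fin m, r ≤ visits x n y → 1 / 4 * r *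
      (stateCount x n y j / (visits x n y : ℝ) - empirical D x n s j) ^ 2 ≤ g y := by
    intro y hy
    have h4 : (stateCount x n y j / (visits x n y : ℝ) - empirical D x n s j) ^ 2 ≤
        ∑ j, (stateCount x n y j / (visits x n y : ℝ) - empirical D x n s j) ^ 2 :=
      Finset.single_le_sum
        (f := fun j => (stateCount x n y j / (visits x n y : ℝ) - empirical D x n s j) ^ 2)
        (fun _ _ => sq_nonneg _) (Finset.mem_univ j)
    exact mul_le_mul (by linarith) h4 (sq_nonneg _) (by positivity)
  have h5 := h3 z hr
  have h6 := h3 z' hr'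
  set a := (stateCount x n z j : ℝ) / visits x n z
  set b := (stateCount x n z' j : ℝ) / visits x n z'
  set e := empirical D x n s j
  nlinarith [mul_nonneg hr0 (sq_nonneg (a + b - 2 * e))]

end LogLik

/-! ### Convergence of the posterior along typical paths -/

/-- The almost sure properties of the path that force the posterior to concentrate on `T`. -/
structure IsTypical {m : ℕ} (D : ℕ) (T : Finset (List (Fin m))) (θ : T → Fin m → ℝ)
    (x : ℕ → Fin m) : Prop where
  stateCount_eq_zero : ∀ (n : ℕ) (z : Fin D → Fin m) (j : Fin m), condProb T θ z j = 0 →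
    stateCount x n z j = 0
  visits_linear : ∀ z : Fin D → Fin m, ∃ c : ℝ, 0 < c ∧ ∀ᶠ n : ℕ in atTop, c * n ≤ visits x n z
  centredCount_sq_le : ∀ (z : Fin D → Fin m) (j : Fin m) (ε : ℝ), 0 < ε → ∀ᶠ n : ℕ in atTop,
    centredCount T θ x n z j ^ 2 ≤ ε * (n * Real.log n)

section Typical

variable {m D : ℕ} {T T' : Finset (List (Fin m))} {θ : T → Fin m → ℝ} {x : ℕ → Fin m}

theorem IsTypical.exists_uniform_visits (hx : IsTypical D T θ x) :
    ∃ c : ℝ, 0 < c ∧ c ≤ 1 ∧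
      ∀ᶠ n : ℕ in atTop, ∀ z : Fin D → Fin m, c * n ≤ visits x n z := by
  choose c hc hcn using hx.visits_linear
  set C : Finset ℝ := insert 1 (Finset.univ.image c) with hC
  have hne : C.Nonempty := ⟨1, Finset.mem_insert_self _ _⟩
  refine ⟨C.min' hne, ?_, C.min'_le _ (Finset.mem_insert_self _ _), ?_⟩
  · rw [Finset.lt_min'_iff]
    intro y hy
    rcases Finset.mem_insert.1 hy with rfl | hy
    · exact one_pos
    · obtain ⟨z, -, rfl⟩ := Finset.mem_image.1 hy
      exact hc z
  · rw [eventually_all]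
    intro z
    filter_upwards [hcn z] with n hn
    refine le_trans (mul_le_mul_of_nonneg_right (C.min'_le _ ?_) (Nat.cast_nonneg n)) hn
    exact Finset.mem_insert_of_mem (Finset.mem_image_of_mem c (Finset.mem_univ z))

theorem tendsto_log_natCast : Tendsto (fun n : ℕ => Real.log n) atTop atTop :=
  Real.tendsto_log_atTop.comp tendsto_natCast_atTop_atTop

theorem isLittleO_log_natCast :
    (fun n : ℕ => Real.log n) =o[atTop] fun n : ℕ => (n : ℝ) :=
  Real.isLittleO_log_id_atTop.comp_tendsto tendsto_natCast_atTop_atTop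

/-- The possible gain from overfitting is negligible against the cost of a parameter. -/
theorem IsTypical.chiSq_isLittleO (hθ : IsParam T θ) (hx : IsTypical D T θ x) :
    (fun n => chiSq D T θ x n) =o[atTop] fun n : ℕ => Real.log n := by
  unfold chiSq
  suffices h : ∀ (z : Fin D → Fin m) (j : Fin m),
      (fun n => centredCount T θ x n z j ^ 2 / (visits x n z * condProb T θ z j))
        =o[atTop] fun n : ℕ => Real.log n from
    Asymptotics.IsLittleO.fun_sum fun z _ => Asymptotics.IsLittleO.fun_sum fun j _ => h z j
  intro z j
  -- For probability zero the term is a division by zero, hence `0`.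
  rcases (condProb_nonneg hθ z j).eq_or_lt with h0 | h0
  · simp only [← h0, mul_zero, div_zero]
    exact Asymptotics.isLittleO_zero (E' := ℝ) _ _
  obtain ⟨c, hc, hcn⟩ := hx.visits_linear z
  refine Asymptotics.IsLittleO.of_bound fun ε hε => ?_
  filter_upwards [hx.centredCount_sq_le z j (ε * (c * condProb T θ z j)) (by positivity), hcn,
    eventually_ge_atTop 1] with n h1 h2 h3
  have hn : (0 : ℝ) < n := by exact_mod_cast h3
  have hlog : 0 ≤ Real.log n := Real.log_natCast_nonneg n
  have hV : 0 < (visits x n z : ℝ) := (by positivity : 0 < c * n).trans_le h2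
  rw [Real.norm_of_nonneg (by positivity), Real.norm_of_nonneg hlog,
    div_le_iff₀ (by positivity)]
  calc _ ≤ ε * (c * condProb T θ z j) * (n * Real.log n) := h1
    _ = ε * Real.log n * (c * n * condProb T θ z j) := by ring
    _ ≤ _ := by gcongr

theorem IsTypical.tendsto_frequency (hx : IsTypical D T θ x) (z : Fin D → Fin m) (j : Fin m) :
    Tendsto (fun n => stateCount x n z j / (visits x n z : ℝ)) atTop (𝓝 (condProb T θ z j)) := by
  obtain ⟨c, hc, hcn⟩ := hx.visits_linear z
  rw [Metric.tendsto_nhds]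
  intro ε hε
  filter_upwards [hx.centredCount_sq_le z j (ε ^ 2 * c ^ 2 / 4) (by positivity), hcn,
    eventually_ge_atTop 1] with n h1 h2 h3
  have hn : (0 : ℝ) < n := by exact_mod_cast h3
  have hV : 0 < (visits x n z : ℝ) := (by positivity : 0 < c * n).trans_le h2
  have hlog : Real.log n ≤ n := (Real.log_le_sub_one_of_pos hn).trans (by linarith)
  have h4 : centredCount T θ x n z j ^ 2 ≤ (ε * visits x n z / 2) ^ 2 := by
    calc _ ≤ ε ^ 2 * c ^ 2 / 4 * (n * Real.log n) := h1
      _ ≤ ε ^ 2 * c ^ 2 / 4 * (n * n) := by gcongr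
      _ = (ε * (c * n) / 2) ^ 2 := by ring
      _ ≤ _ := by gcongr
  have h5 : |centredCount T θ x n z j| ≤ ε * visits x n z / 2 :=
    abs_le_of_sq_le_sq h4 (by positivity)
  have h6 : stateCount x n z j / (visits x n z : ℝ) - condProb T θ z j =
      centredCount T θ x n z j / visits x n z := by
    rw [centredCount]
    field_simp
  rw [Real.dist_eq, h6, abs_div, abs_of_pos hV, div_lt_iff₀ hV]
  linarith [mul_pos hε hV]

/-- Merging strings with different conditional distributions costs a linear amount of
log-likelihood. -/
theorem IsTypical.mergingLoss_linear (hx : IsTypical D T θ x) {u : List (Fin m)} (hu : u ∈ T')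
    {z z' : Fin D → Fin m} (hz : Matches u z) (hz' : Matches u z') {j : Fin m}
    (hne : condProb T θ z j ≠ condProb T θ z' j) :
    ∃ c : ℝ, 0 < c ∧ ∀ᶠ n : ℕ in atTop, c * n ≤ mergingLoss D T' x n := by
  obtain ⟨c, hc, -, hcn⟩ := hx.exists_uniform_visits
  have hlim := ((hx.tendsto_frequency z j).sub (hx.tendsto_frequency z' j)).pow 2
  set d := (condProb T θ z j - condProb T θ z' j) ^ 2 with hd
  have hd0 : 0 < d := by
    have := sub_ne_zero.2 hne
    positivity
  refine ⟨c * d / 16, by positivity, ?_⟩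
  filter_upwards [hcn, hlim.eventually_const_le (by linarith : d / 2 < d)] with n h1 h2
  refine le_trans ?_ (le_mergingLoss hu hz hz' (h1 z) (h1 z') (by positivity) j)
  calc c * d / 16 * n = c * n / 8 * (d / 2) := by ring
    _ ≤ _ := by gcongr

theorem log_marginalLikelihood [NeZero m] (n : ℕ) :
    Real.log (marginalLikelihood D T x n) = ∑ s ∈ T, Real.log (ktProb (count D x n s)) := by
  have hm := Nat.pos_of_ne_zero (NeZero.ne m)
  rw [marginalLikelihood_eq hm, Real.log_prod fun s _ => (ktProb_pos hm _).ne']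

theorem marginalLikelihood_pos [NeZero m] (n : ℕ) : 0 < marginalLikelihood D T x n := by
  have hm := Nat.pos_of_ne_zero (NeZero.ne m)
  rw [marginalLikelihood_eq hm]
  exact Finset.prod_pos fun s _ => ktProb_pos hm _

/-- Every leaf of the tree pays `(m - 1) / 2 * log n`, up to a bounded error. -/
theorem IsTypical.abs_log_marginalLikelihood_sub_le [NeZero m] (hx : IsTypical D T θ x)
    (hT' : T' ∈ models m D) :
    ∃ C : ℝ, ∀ᶠ n : ℕ in atTop, |Real.log (marginalLikelihood D T' x n) -
      (∑ s ∈ T', maxLogLik (count D x n s) - T'.card * (((m : ℝ) - 1) / 2 * Real.log n))| ≤ C := by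
  have hm := Nat.pos_of_ne_zero (NeZero.ne m)
  have hm1 : (1 : ℝ) ≤ m := by exact_mod_cast hm
  obtain ⟨C, hC⟩ := exists_log_ktProb_bound hm
  obtain ⟨c, hc, -, hcn⟩ := hx.exists_uniform_visits
  refine ⟨T'.card * (C + ((m : ℝ) - 1) / 2 * |Real.log c|), ?_⟩
  filter_upwards [hcn, eventually_ge_atTop 1] with n h1 h2
  have hn : (0 : ℝ) < n := by exact_mod_cast h2
  have hconst : (T'.card : ℝ) * (((m : ℝ) - 1) / 2 * Real.log n) =
      ∑ s ∈ T', ((m : ℝ) - 1) / 2 * Real.log n := by simp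
  have hconst' : (T'.card : ℝ) * (C + ((m : ℝ) - 1) / 2 * |Real.log c|) =
      ∑ s ∈ T', (C + ((m : ℝ) - 1) / 2 * |Real.log c|) := by
    rw [Finset.sum_const, nsmul_eq_mul]
  rw [log_marginalLikelihood, hconst, hconst', ← Finset.sum_sub_distrib,
    ← Finset.sum_sub_distrib]
  refine (Finset.abs_sum_le_sum_abs _ _).trans (Finset.sum_le_sum fun s hs => ?_)
  obtain ⟨z, hz⟩ := exists_matches ((mem_models.1 hT').2 s hs)
  have h3 : c * n ≤ (∑ j, count D x n s j : ℕ) :=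
    (h1 z).trans (by exact_mod_cast visits_le_sum_count x n hz)
  have h4 : ((∑ j, count D x n s j : ℕ) : ℝ) ≤ n := by exact_mod_cast sum_count_le x n s
  have hcn0 : 0 < c * n := by positivity
  have h5 : 1 ≤ ∑ j, count D x n s j := by
    have : (0 : ℝ) < (∑ j, count D x n s j : ℕ) := hcn0.trans_le h3
    exact_mod_cast this
  have h6 := hC _ h5
  have h7 := Real.log_le_log hcn0 h3
  have h8 := Real.log_le_log (hcn0.trans_le h3) h4
  rw [Real.log_mul hc.ne' hn.ne'] at h7
  have h9 := neg_abs_le (Real.log c)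
  have h10 := abs_nonneg (Real.log c)
  set L := Real.log (∑ j, count D x n s j : ℕ)
  have hb : 0 ≤ ((m : ℝ) - 1) / 2 := by linarith
  have h11 : ((m : ℝ) - 1) / 2 * (Real.log n - L) ≤ ((m : ℝ) - 1) / 2 * |Real.log c| :=
    mul_le_mul_of_nonneg_left (by linarith) hb
  have h12 : 0 ≤ ((m : ℝ) - 1) / 2 * (Real.log n - L) := mul_nonneg hb (by linarith)
  have h13 : 0 ≤ ((m : ℝ) - 1) / 2 * |Real.log c| := mul_nonneg hb h10
  rw [abs_le] at h6 ⊢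
  constructor <;> nlinarith [h6.1, h6.2]

/-- The marginal likelihood of every other tree is negligible: it loses either a linear amount of
log-likelihood or at least one more term `(m - 1) / 2 * log n`, whereas overfitting gains only
`o(log n)`. -/
theorem IsTypical.tendsto_marginalLikelihood_ratio (hm : 2 ≤ m) (hT : T ∈ models m D)
    (hθ : IsParam T θ) (hmin : IsMinimal T θ) (hx : IsTypical D T θ x) (hT' : T' ∈ models m D)
    (hne : T' ≠ T) :
    Tendsto (fun n => marginalLikelihood D T' x n / marginalLikelihood D T x n) atTop (𝓝 0) := by
  have : NeZero m := ⟨by omega⟩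
  have hm2 : (2 : ℝ) ≤ m := by exact_mod_cast hm
  set b : ℝ := ((m : ℝ) - 1) / 2 with hb
  have hb0 : 0 < b := by rw [hb]; linarith
  obtain ⟨C, hC⟩ := hx.abs_log_marginalLikelihood_sub_le hT
  obtain ⟨C', hC'⟩ := hx.abs_log_marginalLikelihood_sub_le hT'
  obtain ⟨c, hc, -, hcn⟩ := hx.exists_uniform_visits
  have hdiff : ∀ᶠ n : ℕ in atTop, Real.log (marginalLikelihood D T' x n) -
      Real.log (marginalLikelihood D T x n) ≤ chiSq D T θ x n - mergingLoss D T' x n +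
        ((T.card : ℝ) - T'.card) * (b * Real.log n) + (C + C') := by
    filter_upwards [hC, hC', hcn, eventually_ge_atTop 1] with n h1 h2 h3 h4
    have hn : (0 : ℝ) < n := by exact_mod_cast h4
    have h5 := logLik_le_sum_maxLogLik hT hθ (hx.stateCount_eq_zero n)
    have h6 := sum_maxLogLik_le_logLik_add hT hθ (hx.stateCount_eq_zero n)
    have h7 := sum_maxLogLik_le_sub_mergingLoss hT' (x := x) (n := n) fun z => by
      have := (by positivity : 0 < c * n).trans_le (h3 z)
      exact_mod_cast this
    rw [← hb] at h1 h2
    have h8 := (abs_le.1 h1).1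
    have h9 := (abs_le.1 h2).2
    linarith
  have hchi : ∀ ε : ℝ, 0 < ε → ∀ᶠ n : ℕ in atTop, chiSq D T θ x n ≤ ε * Real.log n := by
    intro ε hε
    filter_upwards [(hx.chiSq_isLittleO hθ).def hε] with n hn
    rw [Real.norm_of_nonneg (Real.log_natCast_nonneg n)] at hn
    exact (le_abs_self _).trans hn
  suffices h : Tendsto (fun n => Real.log (marginalLikelihood D T' x n) -
      Real.log (marginalLikelihood D T x n)) atTop atBot by
    refine (Real.tendsto_exp_atBot.comp h).congr fun n => ?_
    rw [Function.comp, Real.exp_sub, Real.exp_log (marginalLikelihood_pos n),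
      Real.exp_log (marginalLikelihood_pos n)]
  rcases exists_merged_or_card_lt hm hT hmin hT' hne with
    ⟨u, hu, z, z', hz, hz', j, hj⟩ | hcard
  · obtain ⟨r, hr, hrn⟩ := hx.mergingLoss_linear hu hz hz' hj
    have hlim : Tendsto (fun n : ℕ => -(r / 2) * (n : ℝ) + (C + C')) atTop atBot :=
      tendsto_atBot_add_const_right _ _
        (tendsto_natCast_atTop_atTop.const_mul_atTop_of_neg (by linarith))
    refine tendsto_atBot_mono' _ ?_ hlim
    have hK : 0 < 1 + T.card * b := by positivity
    filter_upwards [hdiff, hchi 1 one_pos, hrn, isLittleO_log_natCast.def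
      (by positivity : 0 < r / (2 * (1 + T.card * b)))] with n h1 h2 h3 h4
    have hlog := Real.log_natCast_nonneg n
    rw [Real.norm_of_nonneg hlog, Real.norm_of_nonneg (Nat.cast_nonneg n), div_mul_eq_mul_div,
      le_div_iff₀ (by positivity)] at h4
    have h5 : 0 ≤ (T'.card : ℝ) * (b * Real.log n) := by positivity
    nlinarith
  · have hlim : Tendsto (fun n : ℕ => -(b / 2) * Real.log n + (C + C')) atTop atBot :=
      tendsto_atBot_add_const_right _ _
        (tendsto_log_natCast.const_mul_atTop_of_neg (by linarith))
    refine tendsto_atBot_mono' _ ?_ hlim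
    filter_upwards [hdiff, hchi (b / 2) (by positivity)] with n h1 h2
    have hlog := Real.log_natCast_nonneg n
    have h3 := mergingLoss_nonneg (D := D) (T := T') x n
    have h4 : (T.card : ℝ) + 1 ≤ T'.card := by exact_mod_cast hcard
    have h5 : ((T.card : ℝ) - T'.card) * (b * Real.log n) ≤ -1 * (b * Real.log n) :=
      mul_le_mul_of_nonneg_right (by linarith) (by positivity)
    linarith

theorem modelPrior_pos {β : ℝ} (hβ : β ∈ Set.Ioo (0 : ℝ) 1) : 0 < modelPrior D β T :=
  mul_pos (pow_pos (Real.rpow_pos_of_pos (by linarith [hβ.2]) _) _) (pow_pos hβ.1 _)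

theorem IsTypical.tendsto_posterior (hm : 2 ≤ m) {β : ℝ} (hβ : β ∈ Set.Ioo (0 : ℝ) 1)
    (hT : T ∈ models m D) (hθ : IsParam T θ) (hmin : IsMinimal T θ) (hx : IsTypical D T θ x) :
    Tendsto (fun n => posterior D β T x n) atTop (𝓝 1) := by
  have : NeZero m := ⟨by omega⟩
  have hterm : ∀ T' ∈ models m D, Tendsto (fun n =>
      modelPrior D β T' * marginalLikelihood D T' x n /
        (modelPrior D β T * marginalLikelihood D T x n)) atTop (𝓝 (if T' = T then 1 else 0)) := by
    intro T' hT'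
    split_ifs with h
    · subst h
      refine tendsto_const_nhds.congr fun n => (div_self ?_).symm
      exact (mul_pos (modelPrior_pos hβ) (marginalLikelihood_pos n)).ne'
    · have := (hx.tendsto_marginalLikelihood_ratio hm hT hθ hmin hT' h).const_mul
        (modelPrior D β T' / modelPrior D β T)
      rw [mul_zero] at this
      exact this.congr fun n => div_mul_div_comm _ _ _ _
  have hsum := (tendsto_finsetSum _ hterm).inv₀ (by simp [hT])
  rw [Finset.sum_ite_eq' _ T, if_pos hT, inv_one] at hsum
  refine hsum.congr fun n => ?_
  rw [← Finset.sum_div, inv_div, posterior, priorPredictive]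

end Typical

end BCT

theorem theorem6 {Ω : Type*} [MeasurableSpace Ω] (μ : Measure Ω) [IsProbabilityMeasure μ]
    (m D : ℕ) (hm : 2 ≤ m) (β : ℝ) (hβ : β ∈ Set.Ioo (0 : ℝ) 1)
    (T : Finset (List (Fin m))) (hT : T ∈ BCT.models m D)
    (θ : T → Fin m → ℝ) (hθ : BCT.IsParam T θ)
    (hmin : BCT.IsMinimal T θ) (herg : BCT.IsErgodic D T θ)
    (X : ℕ → Ω → Fin m) (hX : BCT.IsVariableMemoryChain μ D T θ X) :
    ∀ᵐ ω ∂μ, Tendsto (fun n => BCT.posterior D β T (fun k => X k ω) n) atTop (𝓝 1) := by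
  have : NeZero m := ⟨by omega⟩
  filter_upwards [BCT.ae_stateCount_eq_zero hX, BCT.ae_visits_linear hT hθ herg hX,
    BCT.ae_centredCount_sq_le hT hθ hX] with ω h₁ h₂ h₃
  have hx : BCT.IsTypical D T θ fun k => X k ω := ⟨h₁, h₂, h₃⟩
  exact hx.tendsto_posterior hm hβ hT hθ hmin
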